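/- Let $d\ge 1$ and $\mathbb{T}^d=(\mathbb{R}/\mathbb{Z})^d$ with its normalised Lebesgue measure. Let $\mathcal{H}$ and $\mathcal{Y}$ be real separable Hilbert spaces, let $\{e_k\}$ be a complete orthonormal basis of $\mathcal{H}$, and let $l^2(\mathcal{H},\mathcal{Y})$ be the space of Hilbert–Schmidt operators $G:\mathcal{H}\to\mathcal{Y}$, with norm $\|G\|_{l^2(\mathcal{H},\mathcal{Y})}=\bigl(\sum_k|Ge_k|_{\mathcal{Y}}^2\bigr)^{1/2}$. For $q\in(1,\infty)$ let $\mathbb{L}^q$ be the space of functions $f:\mathbb{T}^d\to l^2(\mathcal{H},\mathcal{Y})$ such that $fe_k\in L^q(\mathbb{T}^d;\mathcal{Y})$ for each $k$ and $$\|f\|_{\mathbb{L}^q}=\Bigl(\int_{\mathbb{T}^d}\|f(x)\|_{l^2(\mathcal{H},\mathcal{Y})}^q\,dx\Bigr)^{1/q}<\infty .$$ For $n=(n_1,\dots,n_d)\in\mathbb{N}_0^d$ and an integrable $g:\mathbb{T}^d\to\mathcal{Y}$ let $$\mathcal{T}_ng(x)=\sum_{|k_1|\le n_1}\cdots\sum_{|k_d|\le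 n_d}\hat g(k)e^{2\pi i k\cdot x}=\int_{\mathbb{T}^d}g(x-u)D_n(u)\,du,\qquad D_n(u)=\sum_{|k_1|\le n_1}\cdots\sum_{|k_d|\le n_d}e^{2\pi i k\cdot u},$$ and for $f\in\mathbb{L}^q$ define $\mathcal{T}_nf$ by $(\mathcal{T}_nf)e_k=\mathcal{T}_n(fe_k)$ for all $k$. For every $q\in(1,\infty)$ there is a constant $C_q$, depending only on $q$ and $d$, such that for all $f\in\mathbb{L}^q$ and all $n\in\mathbb{N}_0^d$ the function $\mathcal{T}_nf$ is well defined as an $l^2(\mathcal{H},\mathcal{Y})$-valued function, belongs to $\mathbb{L}^q$, and satisfies $$\|\mathcal{T}_nf\|_{\mathbb{L}^q}\le C_q\|f\|_{\mathbb{L}^q}.$$ Moreover, if $f\in\mathbb{L}^q$ has zero mean, i.e. $\int_{\mathbb{T}^d}f(x)e_k\,dx=0$ for all $k$, then $\|\mathcal{T}_nf-f\|_{\mathbb{L}^q}\to0$ as $\min\{n_1,\dots,n_d\}\to\infty$. -/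

import Mathlib

open MeasureTheory Filter Topology
open scoped ENNReal NNReal

noncomputable section

namespace RectSum

/-- The normalised Haar (Lebesgue) measure on the torus `𝕋ᵈ = (ℝ/ℤ)ᵈ`; it is the measure that
`UnitAddTorus.mFourierCoeff` integrates against. -/
def torusMeasure (d : ℕ) : Measure (UnitAddTorus (Fin d)) :=
  Measure.pi fun _ => AddCircle.haarAddCircle

/-- The frequencies `k ∈ ℤᵈ` with `|k₁| ≤ n₁, …, |k_d| ≤ n_d`. -/
def box {d : ℕ} (n : Fin d → ℕ) : Finset (Fin d → ℤ) :=
  Fintype.piFinset fun j => Finset.Icc (-(n j : ℤ)) (n j)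

/-- The rectangular Dirichlet kernel `D_n(u) = ∑_{|k₁| ≤ n₁} ⋯ ∑_{|k_d| ≤ n_d} e^{2πi k·u}`. -/
def dirichletKernel {d : ℕ} (n : Fin d → ℕ) (u : UnitAddTorus (Fin d)) : ℂ :=
  ∑ k ∈ box n, UnitAddTorus.mFourier k u

lemma dirichletKernel_conj {d : ℕ} (n : Fin d → ℕ) (u : UnitAddTorus (Fin d)) :
    starRingEnd ℂ (dirichletKernel n u) = dirichletKernel n u := by
  unfold dirichletKernel
  rw [map_sum]
  refine Finset.sum_nbij' (fun k => -k) (fun k => -k) ?_ ?_ ?_ ?_ ?_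
  · intro k hk
    simp only [box, Fintype.mem_piFinset, Finset.mem_Icc, Pi.neg_apply] at hk ⊢
    exact fun j => ⟨by have := hk j; omega, by have := hk j; omega⟩
  · intro k hk
    simp only [box, Fintype.mem_piFinset, Finset.mem_Icc, Pi.neg_apply] at hk ⊢
    exact fun j => ⟨by have := hk j; omega, by have := hk j; omega⟩
  · intro k _
    simp
  · intro k _
    simp
  · intro k _
    exact UnitAddTorus.mFourier_neg.symm

/-- The Dirichlet kernel is real-valued. -/
lemma dirichletKernel_re {d : ℕ} (n : Fin d → ℕ) (u : UnitAddTorus (Fin d)) :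
    (((dirichletKernel n u).re : ℝ) : ℂ) = dirichletKernel n u :=
  Complex.conj_eq_iff_re.mp (dirichletKernel_conj n u)

/-- The rectangular partial sum `𝒯_n g (x) = ∫ g(x - u) D_n(u) du` of an integrable function
`g : 𝕋ᵈ → Y`, for a real vector space `Y`. By `apply_partialSum` this is
`∑_{|k₁| ≤ n₁} ⋯ ∑_{|k_d| ≤ n_d} ĝ(k) e^{2πi k·x}` in each coordinate of `Y`. -/
def partialSum {d : ℕ} {Y : Type*} [NormedAddCommGroup Y] [NormedSpace ℝ Y]
    (n : Fin d → ℕ) (g : UnitAddTorus (Fin d) → Y) (x : UnitAddTorus (Fin d)) : Y :=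
  ∫ u, (dirichletKernel n u).re • g (x - u) ∂(torusMeasure d)

instance (d : ℕ) : IsProbabilityMeasure (torusMeasure d) :=
  inferInstanceAs (IsProbabilityMeasure (Measure.pi fun _ => AddCircle.haarAddCircle))

instance (d : ℕ) : (torusMeasure d).IsAddHaarMeasure :=
  inferInstanceAs (Measure.IsAddHaarMeasure (Measure.pi fun _ => AddCircle.haarAddCircle))

instance (d : ℕ) : (torusMeasure d).IsNegInvariant :=
  haveI : (AddCircle.haarAddCircle : Measure UnitAddCircle).IsNegInvariant := by
    unfold AddCircle.haarAddCircle
    infer_instance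
  Measure.pi.isNegInvariant fun _ : Fin d => (AddCircle.haarAddCircle : Measure UnitAddCircle)

/-- Every real coordinate of `𝒯_n g` is the rectangular partial sum of the Fourier series of that
coordinate of `g`. -/
theorem apply_partialSum {d : ℕ} {Y : Type*} [NormedAddCommGroup Y] [NormedSpace ℝ Y]
    [CompleteSpace Y] (n : Fin d → ℕ) (g : UnitAddTorus (Fin d) → Y)
    (hg : Integrable g (torusMeasure d)) (ℓ : Y →L[ℝ] ℝ) (x : UnitAddTorus (Fin d)) :
    ((ℓ (partialSum n g x) : ℝ) : ℂ) =
      ∑ k ∈ box n, UnitAddTorus.mFourierCoeff (fun y => ((ℓ (g y) : ℝ) : ℂ)) k *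
        UnitAddTorus.mFourier k x := by
  have hD : Continuous fun u : UnitAddTorus (Fin d) => dirichletKernel n u := by
    unfold dirichletKernel
    fun_prop
  have hgx : Integrable (fun u => g (x - u)) (torusMeasure d) := hg.comp_sub_left x
  have hbd : ∃ M : ℝ, ∀ u, ‖(dirichletKernel n u).re‖ ≤ M := by
    refine ⟨∑ k ∈ box n, ‖UnitAddTorus.mFourier k‖, fun u => ?_⟩
    refine (Complex.abs_re_le_norm _).trans ((norm_sum_le _ _).trans ?_)
    exact Finset.sum_le_sum fun k _ => (UnitAddTorus.mFourier k).norm_coe_le_norm u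
  obtain ⟨M, hM⟩ := hbd
  have hint : Integrable (fun u => (dirichletKernel n u).re • g (x - u)) (torusMeasure d) :=
    hgx.bdd_smul M (Complex.continuous_re.comp hD).aestronglyMeasurable (ae_of_all _ hM)
  have hl : Integrable (fun u => ((ℓ (g u) : ℝ) : ℂ)) (torusMeasure d) :=
    (ℓ.integrable_comp hg).ofReal
  unfold partialSum
  rw [← ContinuousLinearMap.integral_comp_comm ℓ hint, ← integral_complex_ofReal]
  calc ∫ u, ((ℓ ((dirichletKernel n u).re • g (x - u)) : ℝ) : ℂ) ∂(torusMeasure d)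
      = ∫ u, dirichletKernel n u * ((ℓ (g (x - u)) : ℝ) : ℂ) ∂(torusMeasure d) := by
        refine integral_congr_ae (ae_of_all _ fun u => ?_)
        simp only [map_smul, smul_eq_mul, Complex.ofReal_mul, dirichletKernel_re]
    _ = ∫ u, dirichletKernel n (x - u) * ((ℓ (g u) : ℝ) : ℂ) ∂(torusMeasure d) := by
        rw [← integral_sub_left_eq_self _ (torusMeasure d) x]
        simp only [sub_sub_cancel]
    _ = ∫ u, ∑ k ∈ box n, (UnitAddTorus.mFourier (-k) u * ((ℓ (g u) : ℝ) : ℂ)) *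
          UnitAddTorus.mFourier k x ∂(torusMeasure d) := by
        refine integral_congr_ae (ae_of_all _ fun u => ?_)
        simp only [dirichletKernel, Finset.sum_mul]
        refine Finset.sum_congr rfl fun k _ => ?_
        have : UnitAddTorus.mFourier k (x - u) =
            UnitAddTorus.mFourier k x * UnitAddTorus.mFourier (-k) u := by
          simp only [UnitAddTorus.mFourier, ContinuousMap.coe_mk, ← Finset.prod_mul_distrib,
            Pi.sub_apply, Pi.neg_apply]
          refine Finset.prod_congr rfl fun j _ => ?_
          simp [fourier_apply, sub_eq_add_neg, smul_add, AddCircle.toCircle_add]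
        rw [this]
        ring
    _ = _ := by
        rw [integral_finsetSum]
        · refine Finset.sum_congr rfl fun k _ => ?_
          rw [integral_mul_const]
          rfl
        · intro k _
          refine Integrable.mul_const ?_ _
          exact hl.bdd_mul (c := ‖UnitAddTorus.mFourier (-k)‖)
            (UnitAddTorus.mFourier (-k)).continuous.aestronglyMeasurable
            (ae_of_all _ fun u => (UnitAddTorus.mFourier (-k)).norm_coe_le_norm u)

section HilbertSchmidt

variable {ι H : Type*} [NormedAddCommGroup H] [InnerProductSpace ℝ H]

/-- `l²(H, Y)`: the Hilbert–Schmidt operators `G : H → Y`, i.e. the bounded operators with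
`∑_k |G e_k|² < ∞`. -/
def HilbertSchmidt (e : HilbertBasis ι ℝ H) (Y : Type*) [NormedAddCommGroup Y]
    [InnerProductSpace ℝ Y] : Submodule ℝ (H →L[ℝ] Y) where
  carrier := {G | Summable fun k => ‖G (e k)‖ ^ 2}
  zero_mem' := by simp
  add_mem' := by
    intro A B hA hB
    refine Summable.of_nonneg_of_le (fun k => by positivity) (fun k => ?_)
      ((hA.mul_left 2).add (hB.mul_left 2))
    have h1 : ‖(A + B) (e k)‖ ≤ ‖A (e k)‖ + ‖B (e k)‖ := norm_add_le _ _
    nlinarith [sq_nonneg (‖A (e k)‖ - ‖B (e k)‖), norm_nonneg ((A + B) (e k))]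
  smul_mem' := by
    intro c A hA
    have h := Summable.mul_left (‖c‖ ^ 2) hA
    refine h.congr fun k => ?_
    rw [← mul_pow, ← norm_smul]
    rfl

variable {e : HilbertBasis ι ℝ H} {Y : Type*} [NormedAddCommGroup Y] [InnerProductSpace ℝ Y]

/-- The Hilbert–Schmidt norm `(∑_k |G e_k|²)^{1/2}`, as an extended nonnegative number. -/
def hsNorm (G : HilbertSchmidt e Y) : ℝ≥0∞ :=
  (∑' k, ‖G.1 (e k)‖ₑ ^ 2) ^ (1 / 2 : ℝ)

variable {d : ℕ}

/-- The norm `‖f‖_{𝕃^q} = (∫_{𝕋ᵈ} ‖f(x)‖_{l²(H, Y)}^q dx)^{1/q}`. -/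
def LNorm (q : ℝ) (f : UnitAddTorus (Fin d) → HilbertSchmidt e Y) : ℝ≥0∞ :=
  (∫⁻ x, hsNorm (f x) ^ q ∂(torusMeasure d)) ^ (1 / q)

/-- `f ∈ 𝕃^q`: every component `f e_k` belongs to `L^q(𝕋ᵈ; Y)`, and `‖f‖_{𝕃^q} < ∞`. -/
def MemL (q : ℝ) (f : UnitAddTorus (Fin d) → HilbertSchmidt e Y) : Prop :=
  (∀ k, MemLp (fun x => (f x).1 (e k)) (ENNReal.ofReal q) (torusMeasure d)) ∧ LNorm q f < ∞

/-- `f` has zero mean in `x`: every component `f e_k` has. -/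
def ZeroMean (f : UnitAddTorus (Fin d) → HilbertSchmidt e Y) : Prop :=
  ∀ k, ∫ x, (f x).1 (e k) ∂(torusMeasure d) = 0

open Classical in
/-- `𝒯_n f` for operator-valued `f`: the function with values in `l²(H, Y)` that is defined by
`(𝒯_n f) e_k = 𝒯_n (f e_k)` for all `k` (and `0` at those `x` where no operator in `l²(H, Y)` has
these columns). -/
def hsPartialSum (n : Fin d → ℕ) (f : UnitAddTorus (Fin d) → HilbertSchmidt e Y)
    (x : UnitAddTorus (Fin d)) : HilbertSchmidt e Y :=
  if h : ∃ G : HilbertSchmidt e Y,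
      ∀ k, G.1 (e k) = partialSum n (fun y => (f y).1 (e k)) x
  then h.choose else 0

end HilbertSchmidt

/-- `min n = min {n₁, …, n_d}`. -/
def minIndex {d : ℕ} (n : Fin d → ℕ) : ℕ := ⨅ j, n j

end RectSum

end

/-!
The theorem is M. Riesz's theorem on partial sums, carried from the circle to the torus and from
scalars to Hilbert–Schmidt operators.

On the circle and for `1 < p ≤ 2`, let `u` be a strictly positive trigonometric polynomial and `F` an
analytic polynomial with `Re F = u` on the circle. Then `F ^ p` is holomorphic on the disc, and the
inequality `|z| ^ p ≤ A (Re z) ^ p - B Re (z ^ p)` on the right half-plane, averaged over the circle,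
gives `‖F‖_p ≤ A ^ (1 / p) ‖u‖_p` (`circleAverage_norm_rpow_le`,
`eLpNorm_trigPoly_filter_le_of_pos`).
Splitting into positive polynomials extends the bound for the analytic projection to all
trigonometric polynomials (`exists_eLpNorm_trigPoly_filter_nonneg_le`), and partial sums are
differences of two modulated analytic projections.

On the torus, a trigonometric polynomial restricted to a line in a coordinate direction is one of a
single variable, so the frequencies can be cut off one coordinate at a time, and the constants multiply
(`exists_eLpNorm_sum_filter_box_le`). Density of trigonometric polynomials and, for `q > 2`, duality
give the uniform bound on all of `L^q` (`exists_eLpNorm_fourierSum_le`).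

Averaging the scalar bound over random linear combinations of a finite family of functions yields the
bound for square functions with the same constant (`lintegral_sum_sq_partialSum_le`), which passes
to countable families by monotone convergence. The `𝕃^q` norm is such a square function: that of the
matrix entries of `f` with respect to `e` and an orthonormal basis of `Y`. Convergence follows from
the uniform bound and the scalar convergence of finitely many entries
(`tendsto_lintegral_tsum_sq_partialSum_sub`).
-/

noncomputable section

namespace RectSum

open scoped ComplexConjugate Real
open UnitAddTorus

/-! ### The inequality behind Riesz's theorem -/

/-- The pointwise inequality behind M. Riesz's theorem. For `1 < p ≤ 2` the angle `p · arg z`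
goes beyond `π / 2` when `z` approaches the imaginary axis, so that `Re (z ^ p)` is negative there and its
absolute value controls `|z| ^ p`; away from the axis, `Re z` alone controls `|z|`. -/
lemma exists_norm_rpow_le {p : ℝ} (hp1 : 1 < p) (hp2 : p ≤ 2) :
    ∃ A B : ℝ, 0 ≤ A ∧ 0 ≤ B ∧ ∀ z : ℂ, 0 < z.re →
      ‖z‖ ^ p ≤ A * z.re ^ p - B * (z ^ (p : ℂ)).re := by
  have hp0 : 0 < p := by linarith
  -- The angle `t` separates the two regimes: `cos (t * p) < 0 < cos t`.
  obtain ⟨t, ht1, ht2⟩ : ∃ t, π / (2 * p) < t ∧ t < π / 2 := by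
    refine exists_between ?_
    rw [div_lt_div_iff_of_pos_left Real.pi_pos (by positivity) (by norm_num)]
    linarith
  have htpos : 0 < t := lt_trans (by positivity) ht1
  have hpt1 : π / 2 < t * p := by
    rw [div_lt_iff₀ (by positivity)] at ht1
    linarith
  have hpt2 : t * p < π := by nlinarith [Real.pi_pos]
  have hneg : Real.cos (t * p) < 0 := Real.cos_neg_of_pi_div_two_lt_of_lt hpt1 (by linarith)
  have hpos : 0 < Real.cos t := Real.cos_pos_of_mem_Ioo ⟨by linarith, ht2⟩
  set B : ℝ := -(Real.cos (t * p))⁻¹ with hB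
  have hBpos : 0 < B := by rw [hB, neg_pos]; exact inv_lt_zero.mpr hneg
  set A : ℝ := (1 + B) / Real.cos t ^ p with hA
  have hApos : 0 < A := by positivity
  refine ⟨A, B, hApos.le, hBpos.le, fun z hz => ?_⟩
  have hnz : 0 ≤ ‖z‖ := norm_nonneg z
  have hre : z.re = ‖z‖ * Real.cos |z.arg| := by rw [Real.cos_abs, Complex.norm_mul_cos_arg]
  have harg : |z.arg| < π / 2 := Complex.abs_arg_lt_pi_div_two_iff.mpr (Or.inl hz)
  have hcos : 0 < Real.cos |z.arg| :=
    Real.cos_pos_of_mem_Ioo ⟨by linarith [abs_nonneg z.arg, Real.pi_pos], harg⟩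
  have hcp : Real.cos (z.arg * p) = Real.cos (|z.arg| * p) := by
    rw [← Real.cos_abs (z.arg * p), abs_mul, abs_of_pos hp0]
  rw [Complex.cpow_ofReal_re, hcp, hre, Real.mul_rpow hnz hcos.le]
  set a := |z.arg|
  have ha0 : 0 ≤ a := abs_nonneg _
  suffices h : 1 ≤ A * Real.cos a ^ p - B * Real.cos (a * p) by
    have := mul_le_mul_of_nonneg_left h (Real.rpow_nonneg hnz p)
    linarith
  rcases le_total t a with hta | hta
  · have h1 : Real.cos (a * p) ≤ Real.cos (t * p) :=
      Real.cos_le_cos_of_nonneg_of_le_pi (by positivity) (by nlinarith [Real.pi_pos])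
        (by gcongr)
    have h2 : B * Real.cos (a * p) ≤ B * Real.cos (t * p) := by gcongr
    have h3 : B * Real.cos (t * p) = -1 := by rw [hB, neg_mul, inv_mul_cancel₀ hneg.ne]
    have : 0 ≤ A * Real.cos a ^ p := by positivity
    linarith
  · have h1 : Real.cos t ≤ Real.cos a :=
      Real.cos_le_cos_of_nonneg_of_le_pi ha0 (by linarith [Real.pi_pos]) hta
    have h2 : Real.cos t ^ p ≤ Real.cos a ^ p := Real.rpow_le_rpow hpos.le h1 hp0.le
    have h3 : A * Real.cos t ^ p = 1 + B := by rw [hA]; field_simp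
    have h4 : A * Real.cos t ^ p ≤ A * Real.cos a ^ p := by gcongr
    have h5 : B * Real.cos (a * p) ≤ B * 1 := by gcongr; exact Real.cos_le_one _
    linarith

/-- The minimum principle for `Re F`: the maximum principle applied to `exp (-F)`. -/
lemma le_re_of_le_re_sphere {F : ℂ → ℂ} (hF : Differentiable ℂ F) {δ : ℝ}
    (h : ∀ z, ‖z‖ = 1 → δ ≤ (F z).re) {z : ℂ} (hz : ‖z‖ ≤ 1) : δ ≤ (F z).re := by
  have hd : Differentiable ℂ fun w => Complex.exp (-F w) := hF.neg.cexp
  have := Complex.norm_le_of_forall_mem_frontier_norm_le (U := Metric.ball (0 : ℂ) 1)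
    (C := Real.exp (-δ)) Metric.isBounded_ball hd.diffContOnCl (fun w hw => ?_) (z := z) ?_
  · rw [Complex.norm_exp, Real.exp_le_exp, Complex.neg_re] at this
    linarith
  · rw [frontier_ball _ one_ne_zero, mem_sphere_zero_iff_norm] at hw
    rw [Complex.norm_exp, Real.exp_le_exp, Complex.neg_re]
    linarith [h w hw]
  · rw [closure_ball _ one_ne_zero]
    simpa using hz

/-- If `Re F` is positive on the unit circle then `F ^ p` is holomorphic on the disc, and its mean over
the circle is `F 0 ^ p`, a nonnegative number. Averaging the pointwise inequality `hAB` therefore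
leaves only the term with `Re F`. -/
lemma circleAverage_norm_rpow_le {p A B : ℝ} (hp : 0 < p) (hB : 0 ≤ B)
    (hAB : ∀ z : ℂ, 0 < z.re → ‖z‖ ^ p ≤ A * z.re ^ p - B * (z ^ (p : ℂ)).re)
    {F : ℂ → ℂ} (hF : Differentiable ℂ F) {δ : ℝ} (hδ : 0 < δ)
    (h : ∀ z, ‖z‖ = 1 → δ ≤ (F z).re) (h0 : (F 0).im = 0) :
    Real.circleAverage (fun z => ‖F z‖ ^ p) 0 1 ≤
      A * Real.circleAverage (fun z => (F z).re ^ p) 0 1 := by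
  have hpos : ∀ z, ‖z‖ ≤ 1 → 0 < (F z).re := fun z hz =>
    hδ.trans_le (le_re_of_le_re_sphere hF h hz)
  have hG : DifferentiableOn ℂ (fun z => F z ^ (p : ℂ)) (Metric.closedBall 0 1) := by
    intro z hz
    refine ((hF z).cpow (differentiableAt_const _) (Or.inl (hpos z ?_))).differentiableWithinAt
    simpa using hz
  have hGc : DiffContOnCl ℂ (fun z => F z ^ (p : ℂ)) (Metric.ball 0 |(1 : ℝ)|) := by
    rw [abs_one]
    refine DifferentiableOn.diffContOnCl ?_
    rw [closure_ball _ one_ne_zero]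
    exact hG
  have havg := hGc.circleAverage
  have hsub : Metric.sphere (0 : ℂ) |(1 : ℝ)| ⊆ Metric.closedBall 0 1 := by
    rw [abs_one]; exact Metric.sphere_subset_closedBall
  have hci : CircleIntegrable (fun z => F z ^ (p : ℂ)) 0 1 :=
    (hG.continuousOn.mono (by simpa using hsub)).circleIntegrable zero_le_one
  have hcre : CircleIntegrable (fun z => (F z ^ (p : ℂ)).re) 0 1 := by
    refine ContinuousOn.circleIntegrable zero_le_one ?_
    exact Complex.continuous_re.comp_continuousOn
      (hG.continuousOn.mono (by simpa using hsub))
  have hc1 : CircleIntegrable (fun z => ‖F z‖ ^ p) 0 1 :=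
    (hF.continuous.norm.rpow_const fun _ => Or.inr hp.le).continuousOn.circleIntegrable zero_le_one
  have hc2 : CircleIntegrable (fun z => (F z).re ^ p) 0 1 :=
    ((Complex.continuous_re.comp hF.continuous).rpow_const
      fun _ => Or.inr hp.le).continuousOn.circleIntegrable zero_le_one
  have hre : Real.circleAverage (fun z => (F z ^ (p : ℂ)).re) 0 1 = (F 0 ^ (p : ℂ)).re := by
    rw [← havg]
    have := Complex.reCLM.circleAverage_comp_comm hci
    simpa [Function.comp_def] using this
  have hF0 : F 0 = (((F 0).re : ℝ) : ℂ) := by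
    apply Complex.ext <;> simp [h0]
  have hnn : 0 ≤ (F 0 ^ (p : ℂ)).re := by
    have h00 : 0 < (F 0).re := hpos 0 (by simp)
    rw [hF0, ← Complex.ofReal_cpow h00.le, Complex.ofReal_re]
    positivity
  calc Real.circleAverage (fun z => ‖F z‖ ^ p) 0 1
      ≤ Real.circleAverage (fun z => A * (F z).re ^ p - B * (F z ^ (p : ℂ)).re) 0 1 := by
        refine Real.circleAverage_mono hc1 ((hc2.const_smul (a := A)).sub (hcre.const_smul (a := B))) ?_
        intro z hz
        exact hAB _ (hpos z (by simpa using hsub hz))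
    _ = A * Real.circleAverage (fun z => (F z).re ^ p) 0 1 - B * (F 0 ^ (p : ℂ)).re := by
        rw [← hre]
        have := Real.circleAverage_sub (hc2.const_smul (a := A)) (hcre.const_smul (a := B))
        rw [Real.circleAverage_smul, Real.circleAverage_smul] at this
        exact this
    _ ≤ _ := by
        have := mul_nonneg hB hnn
        linarith

lemma circleAverage_eq_integral_haarAddCircle (g : ℂ → ℝ) :
    Real.circleAverage g 0 1 =
      ∫ x : UnitAddCircle, g (fourier 1 x) ∂AddCircle.haarAddCircle := by
  rw [AddCircle.integral_haarAddCircle, ← UnitAddCircle.intervalIntegral_preimage 0]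
  simp only [zero_add, inv_one, one_smul]
  rw [Real.circleAverage]
  have := intervalIntegral.smul_integral_comp_mul_left
    (fun θ => g (circleMap 0 1 θ)) (2 * π) (a := 0) (b := 1)
  rw [mul_zero, mul_one] at this
  rw [← this, smul_smul, inv_mul_cancel₀ (by positivity), one_smul]
  refine intervalIntegral.integral_congr fun x _ => ?_
  simp only [fourier_coe_apply, circleMap]
  congr 1
  push_cast
  simp only [zero_add, one_mul, div_one]
  congr 1
  ring

/-! ### Trigonometric polynomials on the circle and their analytic part -/

/-- The trigonometric polynomial `∑ c k * e^{2πikx}` on the circle with finitely supported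
coefficients `c`. Cutting off frequencies is then `Finsupp.filter`. -/
def trigPoly : (ℤ →₀ ℂ) →ₗ[ℂ] C(UnitAddCircle, ℂ) :=
  Finsupp.linearCombination ℂ fun k => fourier k

lemma trigPoly_apply (c : ℤ →₀ ℂ) (x : UnitAddCircle) :
    trigPoly c x = c.sum fun k a => a * fourier k x := by
  simp [trigPoly, Finsupp.linearCombination_apply, Finsupp.sum, ContinuousMap.sum_apply]

@[simp] lemma trigPoly_single (k : ℤ) (a : ℂ) : trigPoly (Finsupp.single k a) = a • fourier k := by
  simp [trigPoly]

/-- The coefficients of the complex conjugate of `trigPoly c`. So `conjCoeff c = c` says that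
`trigPoly c` is real-valued. -/
def conjCoeff (c : ℤ →₀ ℂ) : ℤ →₀ ℂ :=
  (c.mapRange (starRingEnd ℂ) (map_zero _)).equivMapDomain (Equiv.neg ℤ)

@[simp] lemma conjCoeff_apply (c : ℤ →₀ ℂ) (k : ℤ) : conjCoeff c k = conj (c (-k)) := by
  simp [conjCoeff]

lemma conjCoeff_add (c c' : ℤ →₀ ℂ) : conjCoeff (c + c') = conjCoeff c + conjCoeff c' := by
  ext k; simp

lemma conjCoeff_conjCoeff (c : ℤ →₀ ℂ) : conjCoeff (conjCoeff c) = c := by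
  ext k; simp

lemma conjCoeff_smul (a : ℂ) (c : ℤ →₀ ℂ) : conjCoeff (a • c) = conj a • conjCoeff c := by
  ext k; simp

lemma trigPoly_conjCoeff (c : ℤ →₀ ℂ) (x : UnitAddCircle) :
    trigPoly (conjCoeff c) x = conj (trigPoly c x) := by
  induction c using Finsupp.induction_linear with
  | zero =>
    have : conjCoeff 0 = 0 := by ext; simp
    simp [this]
  | add f g hf hg => rw [conjCoeff_add, map_add, map_add]; simp [hf, hg]
  | single k a =>
    have : conjCoeff (Finsupp.single k a) = Finsupp.single (-k) (conj a) := by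
      ext m
      simp only [conjCoeff_apply, Finsupp.single_apply]
      by_cases h : k = -m
      · simp [h]
      · rw [if_neg h, if_neg (by rintro rfl; simp at h), map_zero]
    rw [this, trigPoly_single, trigPoly_single]
    simp [fourier_neg, -fourier_apply]

/-- The coefficients of the real part of `trigPoly c`. -/
def reCoeff (c : ℤ →₀ ℂ) : ℤ →₀ ℂ := (1 / 2 : ℂ) • (c + conjCoeff c)

/-- The coefficients of the imaginary part of `trigPoly c`, as `Im w = Re (-i w)`. -/
def imCoeff (c : ℤ →₀ ℂ) : ℤ →₀ ℂ := reCoeff (-Complex.I • c)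

lemma conjCoeff_reCoeff (c : ℤ →₀ ℂ) : conjCoeff (reCoeff c) = reCoeff c := by
  rw [reCoeff, conjCoeff_smul, conjCoeff_add, conjCoeff_conjCoeff, add_comm]
  congr 1
  rw [map_div₀, map_one, Complex.conj_ofNat]

lemma trigPoly_reCoeff (c : ℤ →₀ ℂ) (x : UnitAddCircle) :
    trigPoly (reCoeff c) x = ((trigPoly c x).re : ℂ) := by
  rw [reCoeff, map_smul, map_add]
  simp only [ContinuousMap.smul_apply, ContinuousMap.add_apply, trigPoly_conjCoeff,
    Complex.add_conj, smul_eq_mul]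
  push_cast
  ring

lemma trigPoly_imCoeff (c : ℤ →₀ ℂ) (x : UnitAddCircle) :
    trigPoly (imCoeff c) x = ((trigPoly c x).im : ℂ) := by
  rw [imCoeff, trigPoly_reCoeff]
  simp

lemma reCoeff_add_imCoeff (c : ℤ →₀ ℂ) : reCoeff c + Complex.I • imCoeff c = c := by
  ext k
  simp only [reCoeff, imCoeff, Finsupp.add_apply, Finsupp.smul_apply, conjCoeff_apply, smul_eq_mul,
    map_neg, Complex.conj_I, neg_neg, conjCoeff_smul]
  linear_combination (-(1:ℂ)/2) * (c k - conj (c (-k))) * Complex.I_sq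

lemma fourierCoeff_trigPoly (c : ℤ →₀ ℂ) (k : ℤ) : fourierCoeff (trigPoly c) k = c k := by
  induction c using Finsupp.induction_linear with
  | zero => simp [fourierCoeff]
  | add f g hf hg =>
    rw [map_add, Finsupp.add_apply, ← hf, ← hg]
    exact congrFun (fourierCoeff.add
      ((trigPoly f).continuous.integrable_of_hasCompactSupport (HasCompactSupport.of_compactSpace _))
      ((trigPoly g).continuous.integrable_of_hasCompactSupport
        (HasCompactSupport.of_compactSpace _))) k
  | single m a =>
    rw [trigPoly_single]
    have := fourierCoeff.const_smul (⇑(fourier m : C(UnitAddCircle, ℂ))) a k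
    rw [fourierCoeff_fourier] at this
    refine Eq.trans this ?_
    simp [Finsupp.single_apply, Pi.single_apply, eq_comm]

lemma exists_trigPoly_norm_sub_lt (g : C(UnitAddCircle, ℂ)) {ε : ℝ} (hε : 0 < ε) :
    ∃ c, ‖trigPoly c - g‖ < ε := by
  have h : g ∈ (Submodule.span ℂ (Set.range (@fourier 1))).topologicalClosure := by
    rw [span_fourier_closure_eq_top]; trivial
  obtain ⟨y, hy, hyg⟩ := Metric.mem_closure_iff.mp h ε hε
  have hy' : y ∈ LinearMap.range trigPoly := by
    rw [trigPoly, Finsupp.range_linearCombination]; exact hy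
  obtain ⟨c, rfl⟩ := hy'
  exact ⟨c, by rwa [dist_comm, dist_eq_norm] at hyg⟩

lemma eLpNorm_le_ofReal {α : Type*} [MeasurableSpace α] {μ : Measure α} [IsProbabilityMeasure μ]
    {E : Type*} [NormedAddCommGroup E] {f : α → E} {M : ℝ} (p : ℝ≥0∞) (h : ∀ x, ‖f x‖ ≤ M) :
    eLpNorm f p μ ≤ ENNReal.ofReal M := by
  simpa using eLpNorm_le_of_ae_bound (p := p) (μ := μ) (ae_of_all _ h)

lemma memLp_trigPoly (c : ℤ →₀ ℂ) (p : ℝ≥0∞) : MemLp (trigPoly c) p AddCircle.haarAddCircle :=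
  (trigPoly c).continuous.memLp_of_hasCompactSupport (HasCompactSupport.of_compactSpace _)

/-- Bessel's inequality: dropping frequencies does not increase the `L²` norm. -/
lemma eLpNorm_two_trigPoly_filter_le (s : ℤ → Prop) [DecidablePred s] (c : ℤ →₀ ℂ) :
    eLpNorm (trigPoly (c.filter s)) 2 AddCircle.haarAddCircle ≤
      eLpNorm (trigPoly c) 2 AddCircle.haarAddCircle := by
  have key : ∀ c : ℤ →₀ ℂ, HasSum (fun k => ‖c k‖ ^ 2)
      (∫ t, ‖trigPoly c t‖ ^ 2 ∂AddCircle.haarAddCircle) := by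
    intro c
    have := hasSum_sq_fourierCoeff
      (ContinuousMap.toLp (E := ℂ) 2 AddCircle.haarAddCircle ℂ (trigPoly c))
    simp only [fourierCoeff_toLp, fourierCoeff_trigPoly] at this
    convert this using 1
    refine integral_congr_ae ?_
    filter_upwards [ContinuousMap.coeFn_toLp (E := ℂ) (p := 2) (𝕜 := ℂ) AddCircle.haarAddCircle
      (trigPoly c)] with x hx
    rw [hx]
  have hle := hasSum_le (fun k => ?_) (key (c.filter s)) (key c)
  · rw [(memLp_trigPoly _ _).eLpNorm_eq_integral_rpow_norm (by norm_num) (by norm_num),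
      (memLp_trigPoly _ _).eLpNorm_eq_integral_rpow_norm (by norm_num) (by norm_num)]
    simp only [ENNReal.toReal_ofNat, Real.rpow_ofNat]
    gcongr
  · by_cases h : s k
    · rw [Finsupp.filter_apply_pos _ _ h]
    · rw [Finsupp.filter_apply_neg _ _ h]; simp

/-- A real trigonometric polynomial is, up to its mean, twice the real part of its analytic part. -/
lemma two_mul_re_trigPoly_filter {c : ℤ →₀ ℂ} (hc : conjCoeff c = c) (x : UnitAddCircle) :
    2 * (trigPoly (c.filter (0 ≤ ·)) x).re = (trigPoly c x).re + (c 0).re := by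
  -- The frequency `0` is counted twice on the left.
  have hco : c.filter (0 ≤ ·) + conjCoeff (c.filter (0 ≤ ·)) = c + Finsupp.single 0 (c 0) := by
    ext k
    have hk : conj (c (-k)) = c k := by rw [← conjCoeff_apply, hc]
    simp only [Finsupp.add_apply, conjCoeff_apply, Finsupp.filter_apply, Finsupp.single_apply]
    rcases lt_trichotomy k 0 with h | rfl | h
    · rw [if_neg (by omega), if_pos (by omega), if_neg (by omega), hk]; simp
    · simpa using hk
    · rw [if_pos (by omega), if_neg (by omega), if_neg (by omega)]; simp
  have := congrArg (fun c => (trigPoly c x).re) hco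
  simp only [map_add, ContinuousMap.add_apply, Complex.add_re, trigPoly_conjCoeff, Complex.conj_re,
    trigPoly_single, ContinuousMap.smul_apply, fourier_zero, smul_eq_mul, mul_one] at this
  linarith

/-- M. Riesz's bound for the analytic part of a strictly positive trigonometric polynomial: on the
circle, twice the analytic part minus the mean is the boundary value of a polynomial `F` with
`Re F = trigPoly c`. -/
lemma eLpNorm_trigPoly_filter_le_of_pos {p A B : ℝ} (hp : 1 < p) (hA : 0 ≤ A) (hB : 0 ≤ B)
    (hAB : ∀ z : ℂ, 0 < z.re → ‖z‖ ^ p ≤ A * z.re ^ p - B * (z ^ (p : ℂ)).re)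
    {c : ℤ →₀ ℂ} (hc : conjCoeff c = c) {δ : ℝ} (hδ : 0 < δ)
    (h : ∀ x, δ ≤ (trigPoly c x).re) :
    eLpNorm (trigPoly (c.filter (0 ≤ ·))) (ENNReal.ofReal p) AddCircle.haarAddCircle ≤
      ENNReal.ofReal (A ^ p⁻¹ + 1) *
        eLpNorm (trigPoly c) (ENNReal.ofReal p) AddCircle.haarAddCircle := by
  have hp0 : 0 < p := by linarith
  set P := c.filter (0 ≤ ·) with hP
  -- `Int.toNat` loses nothing, as only frequencies `k ≥ 0` occur in `P`.
  set F : ℂ → ℂ := fun z => 2 * (∑ k ∈ P.support, P k * z ^ k.toNat) - c 0 with hF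
  have hFd : Differentiable ℂ F := by
    rw [hF]
    fun_prop
  have hFx : ∀ x : UnitAddCircle, F (fourier 1 x) = 2 * trigPoly P x - c 0 := by
    intro x
    simp only [hF, trigPoly_apply, Finsupp.sum]
    congr 2
    refine Finset.sum_congr rfl fun k hk => ?_
    have hk0 : 0 ≤ k := by
      by_contra hneg
      simp [hP, hneg] at hk
    congr 1
    lift k to ℕ using hk0
    simp [fourier_apply, AddCircle.toCircle_nsmul]
  have hre : ∀ x : UnitAddCircle, (F (fourier 1 x)).re = (trigPoly c x).re := by
    intro x
    rw [hFx, Complex.sub_re]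
    have := two_mul_re_trigPoly_filter hc x
    rw [← hP] at this
    simp
    linarith
  have hF0 : F 0 = c 0 := by
    have : ∑ k ∈ P.support, P k * (0 : ℂ) ^ k.toNat = c 0 := by
      rw [Finset.sum_eq_single 0]
      · simp [hP]
      · intro k hk hk0
        have hk0' : 0 ≤ k := by
          by_contra hneg
          simp [hP, hneg] at hk
        rw [zero_pow (by omega), mul_zero]
      · intro h0
        simpa using h0
    simp only [hF, this]
    ring
  have hF0im : (F 0).im = 0 := by
    rw [hF0, ← Complex.conj_eq_iff_im]
    have := conjCoeff_apply c 0
    rw [hc, neg_zero] at this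
    exact this.symm
  have hsph : ∀ z : ℂ, ‖z‖ = 1 → δ ≤ (F z).re := by
    intro z hz
    obtain ⟨x, hx⟩ : ∃ x : UnitAddCircle, fourier 1 x = z := by
      obtain ⟨x, hx⟩ := (AddCircle.homeomorphCircle (one_ne_zero (α := ℝ))).surjective
        ⟨z, by simpa [Submonoid.unitSphere] using hz⟩
      refine ⟨x, ?_⟩
      rw [fourier_one]
      rw [AddCircle.homeomorphCircle_apply] at hx
      rw [hx]
    rw [← hx, hre]
    exact h x
  have hmain := circleAverage_norm_rpow_le hp0 hB hAB hFd hδ hsph hF0im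
  rw [circleAverage_eq_integral_haarAddCircle, circleAverage_eq_integral_haarAddCircle] at hmain
  simp only [hre] at hmain
  simp only [hFx] at hmain
  have hpne : ENNReal.ofReal p ≠ 0 := by simpa using hp0
  have htop : ENNReal.ofReal p ≠ ∞ := ENNReal.ofReal_ne_top
  set G : C(UnitAddCircle, ℂ) := (2 : ℂ) • trigPoly P - ContinuousMap.const _ (c 0) with hG
  have hGm : MemLp G (ENNReal.ofReal p) AddCircle.haarAddCircle :=
    G.continuous.memLp_of_hasCompactSupport (HasCompactSupport.of_compactSpace _)
  have hint : ∀ f : C(UnitAddCircle, ℝ), Integrable f AddCircle.haarAddCircle := fun f =>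
    f.continuous.integrable_of_hasCompactSupport (HasCompactSupport.of_compactSpace _)
  have hG1 : eLpNorm G (ENNReal.ofReal p) AddCircle.haarAddCircle ≤
      ENNReal.ofReal (A ^ p⁻¹) *
        eLpNorm (trigPoly c) (ENNReal.ofReal p) AddCircle.haarAddCircle := by
    rw [hGm.eLpNorm_eq_integral_rpow_norm hpne htop,
      (memLp_trigPoly c _).eLpNorm_eq_integral_rpow_norm hpne htop,
      ENNReal.toReal_ofReal hp0.le, ← ENNReal.ofReal_mul (by positivity),
      ← Real.mul_rpow hA (integral_nonneg fun x => by positivity)]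
    refine ENNReal.ofReal_le_ofReal (Real.rpow_le_rpow (integral_nonneg fun x => by positivity) ?_
      (by positivity))
    refine le_trans hmain ?_
    refine mul_le_mul_of_nonneg_left (integral_mono ?_ ?_ fun x => ?_) hA
    · exact hint ⟨fun x => (trigPoly c x).re ^ p, (Complex.continuous_re.comp
        (trigPoly c).continuous).rpow_const fun _ => Or.inr hp0.le⟩
    · exact hint ⟨fun x => ‖trigPoly c x‖ ^ p, (trigPoly c).continuous.norm.rpow_const
        fun _ => Or.inr hp0.le⟩
    · exact Real.rpow_le_rpow (hδ.le.trans (h x)) (Complex.re_le_norm _) hp0.le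
  have hc0 : ‖c 0‖ₑ ≤ eLpNorm (trigPoly c) (ENNReal.ofReal p) AddCircle.haarAddCircle := by
    have h0 : c 0 = ∫ t, trigPoly c t ∂AddCircle.haarAddCircle := by
      rw [← fourierCoeff_trigPoly c 0]
      simp [fourierCoeff]
    calc ‖c 0‖ₑ ≤ eLpNorm (trigPoly c) 1 AddCircle.haarAddCircle := by
          rw [h0, eLpNorm_one_eq_lintegral_enorm]
          exact enorm_integral_le_lintegral_enorm _
      _ ≤ _ := eLpNorm_le_eLpNorm_of_exponent_le (by simpa using hp.le)
          (trigPoly c).continuous.aestronglyMeasurable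
  have hPeq : (trigPoly P : UnitAddCircle → ℂ) = (1 / 2 : ℂ) • (⇑G + fun _ => c 0) := by
    ext x
    simp [hG]
  calc eLpNorm (trigPoly P) (ENNReal.ofReal p) AddCircle.haarAddCircle
      ≤ eLpNorm (⇑G + fun _ => c 0) (ENNReal.ofReal p) AddCircle.haarAddCircle := by
        rw [hPeq, eLpNorm_const_smul]
        refine mul_le_of_le_one_left (zero_le) ?_
        rw [← ofReal_norm, ENNReal.ofReal_le_one]
        norm_num
    _ ≤ _ := by
        refine (eLpNorm_add_le G.continuous.aestronglyMeasurable aestronglyMeasurable_const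
          (by simpa using hp.le)).trans ?_
        rw [ENNReal.ofReal_add (by positivity) zero_le_one, add_mul, ENNReal.ofReal_one, one_mul]
        refine add_le_add hG1 ?_
        rw [eLpNorm_const' _ hpne htop]
        simpa using hc0

/-! ### Riesz's theorem on the circle -/

lemma ennreal_le_of_forall_pos_le_add_mul {a b M : ℝ≥0∞} (hM : M ≠ ∞)
    (h : ∀ ε : ℝ, 0 < ε → a ≤ b + M * ENNReal.ofReal ε) : a ≤ b := by
  have ht : Tendsto (fun ε : ℝ => b + M * ENNReal.ofReal ε) (𝓝[>] 0) (𝓝 (b + M * 0)) := by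
    refine tendsto_const_nhds.add (ENNReal.Tendsto.const_mul ?_ (Or.inr hM))
    have := (ENNReal.continuous_ofReal.tendsto 0).mono_left (nhdsWithin_le_nhds (s := Set.Ioi 0))
    simpa using this
  rw [mul_zero, add_zero] at ht
  exact ge_of_tendsto ht (eventually_mem_nhdsWithin.mono fun ε hε => h ε hε)

/-- A nonnegative continuous function, shifted up by `2ε`, is within `ε` of a trigonometric polynomial
that is at least `ε`. -/
lemma exists_pos_trigPoly (g : C(UnitAddCircle, ℝ)) (hg : ∀ x, 0 ≤ g x) {ε : ℝ} (hε : 0 < ε) :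
    ∃ c : ℤ →₀ ℂ, conjCoeff c = c ∧ (∀ x, ε ≤ (trigPoly c x).re) ∧
      ∀ x, ‖trigPoly c x - ((g x + 2 * ε : ℝ) : ℂ)‖ ≤ ε := by
  obtain ⟨a, ha⟩ := exists_trigPoly_norm_sub_lt
    ⟨fun x => ((g x + 2 * ε : ℝ) : ℂ), by fun_prop⟩ hε
  have hax : ∀ x, |(trigPoly a x).re - (g x + 2 * ε)| ≤ ε := by
    intro x
    have h1 := (ContinuousMap.norm_coe_le_norm _ x).trans ha.le
    have h2 := (Complex.abs_re_le_norm _).trans h1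
    simpa using h2
  refine ⟨reCoeff a, conjCoeff_reCoeff a, fun x => ?_, fun x => ?_⟩
  · rw [trigPoly_reCoeff, Complex.ofReal_re]
    have := (abs_le.mp (hax x)).1
    linarith [hg x]
  · rw [trigPoly_reCoeff, ← Complex.ofReal_sub, Complex.norm_real]
    exact hax x

/-- A real trigonometric polynomial is a difference of two strictly positive ones, which approximate
its positive and negative parts, up to a uniformly small error. The analytic part of the error is
small in `L²`, hence in `L^p` because `p ≤ 2`. -/
lemma eLpNorm_trigPoly_filter_le_of_real {p : ℝ} (hp : 1 < p) (hp2 : p ≤ 2) {K : ℝ≥0}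
    (hK : ∀ (c : ℤ →₀ ℂ) (δ : ℝ), conjCoeff c = c → 0 < δ → (∀ x, δ ≤ (trigPoly c x).re) →
      eLpNorm (trigPoly (c.filter (0 ≤ ·))) (ENNReal.ofReal p) AddCircle.haarAddCircle ≤
        K * eLpNorm (trigPoly c) (ENNReal.ofReal p) AddCircle.haarAddCircle)
    {c : ℤ →₀ ℂ} (hc : ∀ x, trigPoly c x = ((trigPoly c x).re : ℂ)) :
    eLpNorm (trigPoly (c.filter (0 ≤ ·))) (ENNReal.ofReal p) AddCircle.haarAddCircle ≤
      2 * K * eLpNorm (trigPoly c) (ENNReal.ofReal p) AddCircle.haarAddCircle := by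
  set P := ENNReal.ofReal p with hP
  have hP1 : 1 ≤ P := by rw [hP]; simpa using hp.le
  set μ : Measure UnitAddCircle := AddCircle.haarAddCircle
  have hm : ∀ c, AEStronglyMeasurable (trigPoly c) μ := fun c =>
    (trigPoly c).continuous.aestronglyMeasurable
  refine ennreal_le_of_forall_pos_le_add_mul (M := 6 * K + 2) ?_ fun ε hε => ?_
  · exact ENNReal.add_ne_top.mpr ⟨ENNReal.mul_ne_top (by simp) (by simp), by simp⟩
  have hbound : ∀ g : C(UnitAddCircle, ℝ), (∀ x, |g x| ≤ ‖trigPoly c x‖) → ∀ a : ℤ →₀ ℂ,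
      (∀ x, ‖trigPoly a x - ((g x + 2 * ε : ℝ) : ℂ)‖ ≤ ε) →
      eLpNorm (trigPoly a) P μ ≤ eLpNorm (trigPoly c) P μ + 3 * ENNReal.ofReal ε := by
    intro g hg a ha
    have hle : ∀ x, ‖trigPoly a x‖ ≤ ‖trigPoly c x‖ + 3 * ε := by
      intro x
      have h1 : ‖((g x + 2 * ε : ℝ) : ℂ)‖ ≤ ‖trigPoly c x‖ + 2 * ε := by
        rw [Complex.norm_real, Real.norm_eq_abs]
        refine (abs_add_le _ _).trans ?_
        rw [abs_of_pos (by positivity : (0:ℝ) < 2 * ε)]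
        linarith [hg x]
      have h2 := norm_le_norm_add_norm_sub' (trigPoly a x) ((g x + 2 * ε : ℝ) : ℂ)
      linarith [ha x]
    calc eLpNorm (trigPoly a) P μ
        ≤ eLpNorm ((fun x => ‖trigPoly c x‖) + fun _ => 3 * ε) P μ := by
          refine eLpNorm_mono_real hle
      _ ≤ eLpNorm (fun x => ‖trigPoly c x‖) P μ + eLpNorm (fun _ => 3 * ε) P μ :=
          eLpNorm_add_le (hm c).norm aestronglyMeasurable_const hP1
      _ ≤ _ := by
          rw [eLpNorm_norm]
          refine add_le_add le_rfl ((eLpNorm_le_ofReal (M := 3 * ε) P fun x => ?_).trans ?_)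
          · rw [Real.norm_of_nonneg (by positivity)]
          · rw [ENNReal.ofReal_mul (by norm_num)]; simp
  have hcre : Continuous fun x => (trigPoly c x).re :=
    Complex.continuous_re.comp (trigPoly c).continuous
  set g₁ : C(UnitAddCircle, ℝ) := ⟨fun x => max (trigPoly c x).re 0, hcre.max continuous_const⟩
  set g₂ : C(UnitAddCircle, ℝ) :=
    ⟨fun x => max (-(trigPoly c x).re) 0, hcre.neg.max continuous_const⟩
  obtain ⟨c₁, hc₁, hpos₁, happ₁⟩ := exists_pos_trigPoly g₁ (fun x => le_max_right _ _) hε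
  obtain ⟨c₂, hc₂, hpos₂, happ₂⟩ := exists_pos_trigPoly g₂ (fun x => le_max_right _ _) hε
  have hn₁ := hbound g₁ (fun x => by
    refine le_trans ?_ (Complex.abs_re_le_norm _)
    rw [abs_of_nonneg (show 0 ≤ g₁ x from le_max_right _ _)]
    exact max_le (le_abs_self _) (abs_nonneg _)) c₁ happ₁
  have hn₂ := hbound g₂ (fun x => by
    refine le_trans ?_ (Complex.abs_re_le_norm _)
    rw [abs_of_nonneg (show 0 ≤ g₂ x from le_max_right _ _)]
    exact max_le (neg_le_abs _) (abs_nonneg _)) c₂ happ₂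
  -- The shifts by `2ε` cancel in `c₁ - c₂`.
  set r := c - (c₁ - c₂) with hr
  have hrx : ∀ x, ‖trigPoly r x‖ ≤ 2 * ε := by
    intro x
    have hgg : g₁ x - g₂ x = (trigPoly c x).re := by
      change max _ _ - max _ _ = _
      rcases le_total 0 (trigPoly c x).re with h | h
      · rw [max_eq_left h, max_eq_right (by linarith), sub_zero]
      · rw [max_eq_right h, max_eq_left (by linarith)]; ring
    have : trigPoly r x = (trigPoly c₂ x - ((g₂ x + 2 * ε : ℝ) : ℂ)) -
        (trigPoly c₁ x - ((g₁ x + 2 * ε : ℝ) : ℂ)) := by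
      rw [hr, map_sub, map_sub, ContinuousMap.sub_apply, ContinuousMap.sub_apply, hc x, ← hgg]
      push_cast
      ring
    rw [this]
    refine (norm_sub_le _ _).trans ?_
    linarith [happ₁ x, happ₂ x]
  have hfilter : c.filter (0 ≤ ·) = c₁.filter (0 ≤ ·) - c₂.filter (0 ≤ ·) + r.filter (0 ≤ ·) := by
    rw [← Finsupp.filter_sub, ← Finsupp.filter_add, hr, add_sub_cancel]
  have hr2 : eLpNorm (trigPoly (r.filter (0 ≤ ·))) P μ ≤ 2 * ENNReal.ofReal ε := by
    calc eLpNorm (trigPoly (r.filter (0 ≤ ·))) P μ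
        ≤ eLpNorm (trigPoly (r.filter (0 ≤ ·))) 2 μ :=
          eLpNorm_le_eLpNorm_of_exponent_le (by rw [hP]; simpa using ENNReal.ofReal_le_ofReal hp2)
            (hm _)
      _ ≤ eLpNorm (trigPoly r) 2 μ := eLpNorm_two_trigPoly_filter_le _ _
      _ ≤ ENNReal.ofReal (2 * ε) := eLpNorm_le_ofReal _ hrx
      _ = _ := by rw [ENNReal.ofReal_mul (by norm_num)]; simp
  rw [hfilter, map_add, map_sub, ContinuousMap.coe_add, ContinuousMap.coe_sub]
  refine (eLpNorm_add_le ((hm _).sub (hm _)) (hm _) hP1).trans ?_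
  refine (add_le_add (eLpNorm_sub_le (hm _) (hm _) hP1) hr2).trans ?_
  refine (add_le_add (add_le_add ((hK c₁ ε hc₁ hε hpos₁).trans (mul_le_mul_right hn₁ _))
    ((hK c₂ ε hc₂ hε hpos₂).trans (mul_le_mul_right hn₂ _))) le_rfl).trans ?_
  apply le_of_eq
  ring

/-- M. Riesz's theorem for `1 < p ≤ 2`: the analytic projection is bounded in `L^p` on trigonometric
polynomials. -/
lemma exists_eLpNorm_trigPoly_filter_nonneg_le {p : ℝ} (hp : 1 < p) (hp2 : p ≤ 2) :
    ∃ K : ℝ≥0, ∀ c : ℤ →₀ ℂ,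
      eLpNorm (trigPoly (c.filter (0 ≤ ·))) (ENNReal.ofReal p) AddCircle.haarAddCircle ≤
        K * eLpNorm (trigPoly c) (ENNReal.ofReal p) AddCircle.haarAddCircle := by
  obtain ⟨A, B, hA, hB, hAB⟩ := exists_norm_rpow_le hp hp2
  set K : ℝ≥0 := (A ^ p⁻¹ + 1).toNNReal
  have hK := fun (c : ℤ →₀ ℂ) {x} => eLpNorm_trigPoly_filter_le_of_real hp hp2 (K := K)
    (fun c δ hc hδ h => eLpNorm_trigPoly_filter_le_of_pos hp hA hB hAB hc hδ h) (c := c) x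
  refine ⟨4 * K, fun c => ?_⟩
  set P := ENNReal.ofReal p with hP
  have hP1 : 1 ≤ P := by rw [hP]; simpa using hp.le
  have hm : ∀ c, AEStronglyMeasurable (trigPoly c) AddCircle.haarAddCircle := fun c =>
    (trigPoly c).continuous.aestronglyMeasurable
  have hre := hK (reCoeff c) (x := fun x => by rw [trigPoly_reCoeff, Complex.ofReal_re])
  have him := hK (imCoeff c) (x := fun x => by rw [trigPoly_imCoeff, Complex.ofReal_re])
  have hre' : eLpNorm (trigPoly (reCoeff c)) P AddCircle.haarAddCircle ≤
      eLpNorm (trigPoly c) P AddCircle.haarAddCircle := eLpNorm_mono fun x => by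
    rw [trigPoly_reCoeff, Complex.norm_real]; exact Complex.abs_re_le_norm _
  have him' : eLpNorm (trigPoly (imCoeff c)) P AddCircle.haarAddCircle ≤
      eLpNorm (trigPoly c) P AddCircle.haarAddCircle := eLpNorm_mono fun x => by
    rw [trigPoly_imCoeff, Complex.norm_real]; exact Complex.abs_im_le_norm _
  have hsplit : c.filter (0 ≤ ·) =
      (reCoeff c).filter (0 ≤ ·) + Complex.I • (imCoeff c).filter (0 ≤ ·) := by
    rw [← Finsupp.filter_smul, ← Finsupp.filter_add, reCoeff_add_imCoeff]
  rw [hsplit, map_add, map_smul, ContinuousMap.coe_add, ContinuousMap.coe_smul]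
  refine (eLpNorm_add_le (hm _) ((hm _).const_smul _) hP1).trans ?_
  rw [eLpNorm_const_smul]
  have hI : ‖Complex.I‖ₑ = 1 := by simp [enorm]
  rw [hI, one_mul]
  refine (add_le_add (hre.trans (mul_le_mul_right hre' _))
    (him.trans (mul_le_mul_right him' _))).trans (le_of_eq ?_)
  push_cast
  ring

lemma eLpNorm_trigPoly_equivMapDomain_addRight (m : ℤ) (c : ℤ →₀ ℂ) (p : ℝ≥0∞) :
    eLpNorm (trigPoly (c.equivMapDomain (Equiv.addRight m))) p AddCircle.haarAddCircle =
      eLpNorm (trigPoly c) p AddCircle.haarAddCircle := by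
  have h : ∀ x, trigPoly (c.equivMapDomain (Equiv.addRight m)) x =
      fourier m x * trigPoly c x := by
    intro x
    rw [trigPoly_apply, trigPoly_apply, Finsupp.sum_equivMapDomain, Finsupp.mul_sum]
    refine Finsupp.sum_congr fun k _ => ?_
    rw [Equiv.coe_addRight, fourier_add]
    ring
  refine eLpNorm_congr_norm_ae (ae_of_all _ fun x => ?_)
  rw [h, norm_mul, fourier_apply, Circle.norm_coe, one_mul]

/-- The partial sums on the circle are differences of two analytic projections conjugated by
characters, hence bounded uniformly in `n`. -/
lemma exists_eLpNorm_trigPoly_filter_abs_le {p : ℝ} (hp : 1 < p) (hp2 : p ≤ 2) :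
    ∃ K : ℝ≥0, ∀ (n : ℕ) (c : ℤ →₀ ℂ),
      eLpNorm (trigPoly (c.filter (fun k => |k| ≤ (n : ℤ)))) (ENNReal.ofReal p)
          AddCircle.haarAddCircle ≤
        K * eLpNorm (trigPoly c) (ENNReal.ofReal p) AddCircle.haarAddCircle := by
  obtain ⟨K, hK⟩ := exists_eLpNorm_trigPoly_filter_nonneg_le hp hp2
  refine ⟨2 * K, fun n c => ?_⟩
  have hP1 : 1 ≤ ENNReal.ofReal p := by simpa using hp.le
  have hm : ∀ c, AEStronglyMeasurable (trigPoly c) AddCircle.haarAddCircle := fun c =>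
    (trigPoly c).continuous.aestronglyMeasurable
  -- Cutting off at `m` instead of `0` amounts to a translation of frequencies, which preserves norms.
  have hhalf : ∀ m : ℤ, eLpNorm (trigPoly (c.filter (m ≤ ·))) (ENNReal.ofReal p)
      AddCircle.haarAddCircle ≤
        K * eLpNorm (trigPoly c) (ENNReal.ofReal p) AddCircle.haarAddCircle := by
    intro m
    have hsh : c.filter (m ≤ ·) = ((c.equivMapDomain (Equiv.addRight (-m))).filter
        (0 ≤ ·)).equivMapDomain (Equiv.addRight m) := by
      ext k
      simp [Finsupp.filter_apply]
    rw [hsh, eLpNorm_trigPoly_equivMapDomain_addRight]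
    refine (hK _).trans ?_
    rw [eLpNorm_trigPoly_equivMapDomain_addRight]
  have hsplit : c.filter (fun k => |k| ≤ (n : ℤ)) =
      c.filter (-(n : ℤ) ≤ ·) - c.filter ((n : ℤ) + 1 ≤ ·) := by
    ext k
    simp only [Finsupp.sub_apply, Finsupp.filter_apply, abs_le]
    split_ifs <;> first | omega | simp
  rw [hsplit, map_sub, ContinuousMap.coe_sub]
  refine (eLpNorm_sub_le (hm _) (hm _) hP1).trans
    ((add_le_add (hhalf _) (hhalf _)).trans (le_of_eq ?_))
  push_cast
  ring

/-- The bound on the circle for a sum of characters whose frequencies may repeat, as is the case for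
the restriction to a line of a trigonometric polynomial on the torus. -/
lemma exists_eLpNorm_sum_filter_abs_le {p : ℝ} (hp : 1 < p) (hp2 : p ≤ 2) :
    ∃ K : ℝ≥0, ∀ (n : ℕ) {I : Type} (s : Finset I) (a : I → ℂ) (m : I → ℤ),
      eLpNorm (fun t : UnitAddCircle => ∑ i ∈ s with |m i| ≤ (n : ℤ), a i * fourier (m i) t)
          (ENNReal.ofReal p) AddCircle.haarAddCircle ≤
        K * eLpNorm (fun t : UnitAddCircle => ∑ i ∈ s, a i * fourier (m i) t)
          (ENNReal.ofReal p) AddCircle.haarAddCircle := by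
  obtain ⟨K, hK⟩ := exists_eLpNorm_trigPoly_filter_abs_le hp hp2
  refine ⟨K, fun n I s a m => ?_⟩
  have key : ∀ s : Finset I, (fun t : UnitAddCircle => ∑ i ∈ s, a i * fourier (m i) t) =
      trigPoly (∑ i ∈ s, Finsupp.single (m i) (a i)) := by
    intro s
    ext t
    simp only [map_sum, trigPoly_single, ContinuousMap.sum_apply, ContinuousMap.smul_apply,
      smul_eq_mul]
  have hfil : ∑ i ∈ s with |m i| ≤ (n : ℤ), Finsupp.single (m i) (a i) =
      (∑ i ∈ s, Finsupp.single (m i) (a i)).filter (fun k => |k| ≤ (n : ℤ)) := by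
    rw [Finsupp.filter_sum, Finset.sum_filter]
    refine Finset.sum_congr rfl fun i _ => ?_
    split_ifs with h
    · exact (Finsupp.filter_single_of_pos (fun k => |k| ≤ (n : ℤ)) h).symm
    · exact (Finsupp.filter_single_of_neg (fun k => |k| ≤ (n : ℤ)) h).symm
  rw [key, key, hfil]
  exact hK n _

/-! ### Rectangular sums of scalar functions on the torus -/

variable {d : ℕ}

lemma mem_box {n : Fin d → ℕ} {k : Fin d → ℤ} : k ∈ box n ↔ ∀ j, |k j| ≤ n j := by
  simp [box, abs_le]

lemma mFourier_add_single (k : Fin d → ℤ) (x : UnitAddTorus (Fin d)) (j : Fin d)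
    (t : UnitAddCircle) :
    mFourier k (x + Pi.single j t) = mFourier k x * fourier (k j) t := by
  simp only [mFourier, ContinuousMap.coe_mk, Pi.add_apply]
  have h : ∀ i, (fourier (k i) (x i + (Pi.single j t : Fin d → UnitAddCircle) i) : ℂ) =
      fourier (k i) (x i) * fourier (k i) ((Pi.single j t : Fin d → UnitAddCircle) i) := by
    intro i
    simp [fourier_apply, smul_add, AddCircle.toCircle_add]
  rw [Finset.prod_congr rfl fun i _ => h i, Finset.prod_mul_distrib]
  congr 1
  rw [Finset.prod_eq_single j]
  · rw [Pi.single_eq_same]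
  · intro i _ hij
    rw [Pi.single_eq_of_ne hij, fourier_eval_zero]
  · simp

/-- Averaging over translations in the `j`-th coordinate does not change the integral. This replaces a
Fubini decomposition of the torus along that coordinate. -/
lemma lintegral_torus_eq_lintegral_lintegral_add_single (j : Fin d)
    {G : UnitAddTorus (Fin d) → ℝ≥0∞} (hG : Continuous G) :
    ∫⁻ x, G x ∂torusMeasure d =
      ∫⁻ x, ∫⁻ t, G (x + Pi.single j t) ∂AddCircle.haarAddCircle ∂torusMeasure d := by
  rw [lintegral_lintegral_swap]
  · simp only [lintegral_add_right_eq_self, lintegral_const, measure_univ, mul_one]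
  · refine (hG.comp ?_).measurable.aemeasurable
    have : Continuous fun t : UnitAddCircle => (Pi.single j t : UnitAddTorus (Fin d)) :=
      continuous_single (A := fun _ : Fin d => UnitAddCircle) j
    exact continuous_fst.add (this.comp continuous_snd)

lemma eLpNorm_ofReal_eq {α E : Type*} [MeasurableSpace α] [NormedAddCommGroup E] {p : ℝ}
    (hp : 0 < p) (f : α → E) (μ : Measure α) :
    eLpNorm f (ENNReal.ofReal p) μ = (∫⁻ x, ‖f x‖ₑ ^ p ∂μ) ^ (1 / p) := by
  rw [eLpNorm_eq_lintegral_rpow_enorm_toReal (by simpa using hp) ENNReal.ofReal_ne_top,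
    ENNReal.toReal_ofReal hp.le]

lemma eLpNorm_rpow_eq {α E : Type*} [MeasurableSpace α] [NormedAddCommGroup E] {p : ℝ}
    (hp : 0 < p) (f : α → E) (μ : Measure α) :
    eLpNorm f (ENNReal.ofReal p) μ ^ p = ∫⁻ x, ‖f x‖ₑ ^ p ∂μ := by
  rw [eLpNorm_ofReal_eq hp, one_div, ENNReal.rpow_inv_rpow hp.ne']

/-- A bound for one-dimensional partial sums carries over to cutting off the `j`-th frequency on the
torus: on each line in direction `j` a trigonometric polynomial is one of a single variable. -/
lemma lintegral_sum_filter_coord_le {p : ℝ} (hp : 1 < p) {K : ℝ≥0}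
    (hK : ∀ (n : ℕ) {I : Type} (s : Finset I) (a : I → ℂ) (m : I → ℤ),
      eLpNorm (fun t : UnitAddCircle => ∑ i ∈ s with |m i| ≤ (n : ℤ), a i * fourier (m i) t)
          (ENNReal.ofReal p) AddCircle.haarAddCircle ≤
        K * eLpNorm (fun t : UnitAddCircle => ∑ i ∈ s, a i * fourier (m i) t)
          (ENNReal.ofReal p) AddCircle.haarAddCircle)
    (j : Fin d) (n : ℕ) (s : Finset (Fin d → ℤ)) (a : (Fin d → ℤ) → ℂ) :
    ∫⁻ x, ‖∑ k ∈ s with |k j| ≤ (n : ℤ), a k * mFourier k x‖ₑ ^ p ∂torusMeasure d ≤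
      (K : ℝ≥0∞) ^ p * ∫⁻ x, ‖∑ k ∈ s, a k * mFourier k x‖ₑ ^ p ∂torusMeasure d := by
  have hp0 : 0 < p := by linarith
  have hcont : ∀ s : Finset (Fin d → ℤ), Continuous fun x : UnitAddTorus (Fin d) =>
      ‖∑ k ∈ s, a k * mFourier k x‖ₑ ^ p := fun s => by fun_prop
  rw [lintegral_torus_eq_lintegral_lintegral_add_single j (hcont _),
    lintegral_torus_eq_lintegral_lintegral_add_single j (hcont _),
    ← lintegral_const_mul' _ _ (ENNReal.rpow_ne_top_of_nonneg hp0.le ENNReal.coe_ne_top)]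
  refine lintegral_mono fun x => ?_
  simp only [mFourier_add_single, ← mul_assoc]
  rw [← eLpNorm_rpow_eq hp0, ← eLpNorm_rpow_eq hp0, ← ENNReal.mul_rpow_of_nonneg _ _ hp0.le]
  exact ENNReal.rpow_le_rpow (hK n s (fun k => a k * mFourier k x) (fun k => k j)) hp0.le

lemma exists_eLpNorm_sum_filter_box_le (d : ℕ) {p : ℝ} (hp : 1 < p) (hp2 : p ≤ 2) :
    ∃ K : ℝ≥0, ∀ (n : Fin d → ℕ) (s : Finset (Fin d → ℤ)) (a : (Fin d → ℤ) → ℂ),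
      eLpNorm (fun x => ∑ k ∈ s with k ∈ box n, a k * mFourier k x) (ENNReal.ofReal p)
        (torusMeasure d) ≤
      K * eLpNorm (fun x => ∑ k ∈ s, a k * mFourier k x) (ENNReal.ofReal p) (torusMeasure d) := by
  obtain ⟨K, hK⟩ := exists_eLpNorm_sum_filter_abs_le hp hp2
  have hp0 : 0 < p := by linarith
  refine ⟨K ^ d, fun n s a => ?_⟩
  have key : ∀ J : Finset (Fin d),
      ∫⁻ x, ‖∑ k ∈ s with ∀ j ∈ J, |k j| ≤ (n j : ℤ), a k * mFourier k x‖ₑ ^ p ∂torusMeasure d ≤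
      ((K : ℝ≥0∞) ^ p) ^ J.card * ∫⁻ x, ‖∑ k ∈ s, a k * mFourier k x‖ₑ ^ p ∂torusMeasure d := by
    intro J
    induction J using Finset.induction_on with
    | empty => simp
    | insert j J hj ih =>
      have hs : s.filter (fun k => ∀ i ∈ insert j J, |k i| ≤ (n i : ℤ)) =
          (s.filter (fun k => ∀ i ∈ J, |k i| ≤ (n i : ℤ))).filter (fun k => |k j| ≤ (n j : ℤ)) := by
        rw [Finset.filter_filter]
        refine Finset.filter_congr fun k _ => ?_
        rw [Finset.forall_mem_insert, and_comm]
      rw [hs, Finset.card_insert_of_notMem hj, pow_succ', mul_assoc]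
      exact (lintegral_sum_filter_coord_le hp hK j (n j) _ a).trans (mul_le_mul_right ih _)
  have := key Finset.univ
  simp only [Finset.mem_univ, true_implies, Finset.card_univ, Fintype.card_fin,
    ← mem_box] at this
  rw [← ENNReal.rpow_le_rpow_iff hp0, ENNReal.mul_rpow_of_nonneg _ _ hp0.le, eLpNorm_rpow_eq hp0,
    eLpNorm_rpow_eq hp0]
  refine this.trans (le_of_eq ?_)
  congr 1
  push_cast
  rw [← ENNReal.rpow_natCast, ← ENNReal.rpow_natCast, ← ENNReal.rpow_mul, ← ENNReal.rpow_mul,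
    mul_comm]

/-- The rectangular partial sum of the Fourier series of a scalar function, written through its Fourier
coefficients. -/
def fourierSum (n : Fin d → ℕ) (f : UnitAddTorus (Fin d) → ℂ) (x : UnitAddTorus (Fin d)) : ℂ :=
  ∑ k ∈ box n, mFourierCoeff f k * mFourier k x

lemma mFourierCoeff_eq (f : UnitAddTorus (Fin d) → ℂ) (k : Fin d → ℤ) :
    mFourierCoeff f k = ∫ t, mFourier (-k) t * f t ∂torusMeasure d := rfl

lemma integrable_of_continuous {E : Type*} [NormedAddCommGroup E]
    {f : UnitAddTorus (Fin d) → E} (hf : Continuous f) : Integrable f (torusMeasure d) :=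
  hf.integrable_of_hasCompactSupport (HasCompactSupport.of_compactSpace _)

lemma memLp_of_continuous {E : Type*} [NormedAddCommGroup E]
    {f : UnitAddTorus (Fin d) → E} (hf : Continuous f) (p : ℝ≥0∞) : MemLp f p (torusMeasure d) :=
  hf.memLp_of_hasCompactSupport (HasCompactSupport.of_compactSpace _)

lemma integrable_mFourier_mul (k : Fin d → ℤ) {f : UnitAddTorus (Fin d) → ℂ}
    (hf : Integrable f (torusMeasure d)) :
    Integrable (fun t => mFourier k t * f t) (torusMeasure d) :=
  hf.bdd_mul (c := ‖mFourier k‖) (mFourier k).continuous.aestronglyMeasurable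
    (ae_of_all _ fun u => (mFourier k).norm_coe_le_norm u)

lemma mFourierCoeff_add {f g : UnitAddTorus (Fin d) → ℂ} (hf : Integrable f (torusMeasure d))
    (hg : Integrable g (torusMeasure d)) (k : Fin d → ℤ) :
    mFourierCoeff (f + g) k = mFourierCoeff f k + mFourierCoeff g k := by
  simp only [mFourierCoeff_eq, Pi.add_apply, mul_add]
  exact integral_add (integrable_mFourier_mul _ hf) (integrable_mFourier_mul _ hg)

lemma mFourierCoeff_const_mul (f : UnitAddTorus (Fin d) → ℂ) (c : ℂ) (k : Fin d → ℤ) :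
    mFourierCoeff (fun x => c * f x) k = c * mFourierCoeff f k := by
  simp only [mFourierCoeff_eq, ← integral_const_mul]
  congr 1
  ext t
  ring

lemma mFourierCoeff_sum {I : Type*} (s : Finset I) (f : I → UnitAddTorus (Fin d) → ℂ)
    (hf : ∀ i ∈ s, Integrable (f i) (torusMeasure d)) (k : Fin d → ℤ) :
    mFourierCoeff (fun x => ∑ i ∈ s, f i x) k = ∑ i ∈ s, mFourierCoeff (f i) k := by
  simp only [mFourierCoeff_eq, Finset.mul_sum]
  exact integral_finsetSum _ fun i hi => integrable_mFourier_mul _ (hf i hi)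

lemma fourierSum_add {f g : UnitAddTorus (Fin d) → ℂ} (hf : Integrable f (torusMeasure d))
    (hg : Integrable g (torusMeasure d)) (n : Fin d → ℕ) :
    fourierSum n (f + g) = fourierSum n f + fourierSum n g := by
  ext x
  simp only [fourierSum, mFourierCoeff_add hf hg, add_mul, Finset.sum_add_distrib, Pi.add_apply]

lemma fourierSum_sum_const_mul {I : Type*} (s : Finset I) (z : I → ℂ)
    (f : I → UnitAddTorus (Fin d) → ℂ) (hf : ∀ i ∈ s, Integrable (f i) (torusMeasure d))
    (n : Fin d → ℕ) (x : UnitAddTorus (Fin d)) :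
    fourierSum n (fun x => ∑ i ∈ s, z i * f i x) x = ∑ i ∈ s, z i * fourierSum n (f i) x := by
  simp only [fourierSum]
  simp_rw [mFourierCoeff_sum s (fun i x => z i * f i x) (fun i hi => (hf i hi).const_mul _),
    mFourierCoeff_const_mul, Finset.sum_mul, Finset.mul_sum]
  rw [Finset.sum_comm]
  simp_rw [mul_assoc]

lemma continuous_fourierSum (n : Fin d → ℕ) (f : UnitAddTorus (Fin d) → ℂ) :
    Continuous (fourierSum n f) := by
  unfold fourierSum
  fun_prop

lemma mFourierCoeff_mFourier (m k : Fin d → ℤ) :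
    mFourierCoeff (mFourier m) k = if k = m then 1 else 0 := by
  have h1 : ∀ t, mFourier (-k) t * mFourier m t =
      ∏ i, (fourier (m i - k i) (t i) : ℂ) := by
    intro t
    rw [← mFourier_add]
    simp only [mFourier, ContinuousMap.coe_mk, Pi.add_apply, Pi.neg_apply]
    refine Finset.prod_congr rfl fun i _ => ?_
    rw [neg_add_eq_sub]
  have h2 : ∀ l : ℤ, ∫ t : UnitAddCircle, (fourier l t : ℂ) ∂AddCircle.haarAddCircle =
      if l = 0 then 1 else 0 := by
    intro l
    have := congrFun (fourierCoeff_fourier (T := 1) l) 0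
    rw [fourierCoeff] at this
    simp only [neg_zero, fourier_zero, one_smul] at this
    rw [this, Pi.single_apply]
    simp [eq_comm]
  rw [mFourierCoeff_eq]
  simp only [h1]
  rw [torusMeasure, integral_fintype_prod_eq_prod (fun i (t : UnitAddCircle) =>
    (fourier (m i - k i) t : ℂ))]
  simp only [h2, sub_eq_zero]
  split_ifs with h
  · subst h; simp
  · obtain ⟨i, hi⟩ := Function.ne_iff.mp h
    exact Finset.prod_eq_zero (Finset.mem_univ i) (if_neg (Ne.symm hi))

lemma fourierSum_mFourier_sum (n : Fin d → ℕ) (s : Finset (Fin d → ℤ)) (a : (Fin d → ℤ) → ℂ) :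
    fourierSum n (fun x => ∑ k ∈ s, a k * mFourier k x) =
      fun x => ∑ k ∈ s with k ∈ box n, a k * mFourier k x := by
  ext x
  rw [fourierSum_sum_const_mul s a (fun k => mFourier k)
    fun k _ => integrable_of_continuous (mFourier k).continuous, Finset.sum_filter]
  refine Finset.sum_congr rfl fun k _ => ?_
  simp only [fourierSum, mFourierCoeff_mFourier, ite_mul, one_mul, zero_mul, Finset.sum_ite_eq']
  simp

/-- A crude bound, not uniform in `n`, that serves to pass to limits for fixed `n`. -/
lemma enorm_fourierSum_le (n : Fin d → ℕ) (f : UnitAddTorus (Fin d) → ℂ)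
    (x : UnitAddTorus (Fin d)) :
    ‖fourierSum n f x‖ₑ ≤ (box n).card * eLpNorm f 1 (torusMeasure d) := by
  have h : ∀ k (x : UnitAddTorus (Fin d)), ‖mFourier k x‖ₑ ≤ 1 := by
    intro k x
    rw [← ofReal_norm, ENNReal.ofReal_le_one]
    exact ((mFourier k).norm_coe_le_norm x).trans mFourier_norm.le
  refine (enorm_sum_le _ _).trans ?_
  rw [← nsmul_eq_mul]
  refine Finset.sum_le_card_nsmul _ _ _ fun k _ => ?_
  rw [enorm_mul]
  refine (mul_le_of_le_one_right (zero_le) (h k x)).trans ?_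
  rw [mFourierCoeff_eq, eLpNorm_one_eq_lintegral_enorm]
  refine (enorm_integral_le_lintegral_enorm _).trans (lintegral_mono fun t => ?_)
  rw [enorm_mul]
  exact mul_le_of_le_one_left (zero_le) (h _ _)

/-- Trigonometric polynomials are dense in `L^p` of the torus. -/
lemma exists_eLpNorm_sub_sum_mFourier_le {p : ℝ≥0∞} (hp : p ≠ ∞)
    {f : UnitAddTorus (Fin d) → ℂ} (hf : MemLp f p (torusMeasure d)) {ε : ℝ} (hε : 0 < ε)
    (hp1 : 1 ≤ p) :
    ∃ (s : Finset (Fin d → ℤ)) (a : (Fin d → ℤ) → ℂ),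
      eLpNorm (f - fun x => ∑ k ∈ s, a k * mFourier k x) p (torusMeasure d) ≤
        ENNReal.ofReal ε := by
  obtain ⟨g, hg, -⟩ := hf.exists_boundedContinuous_eLpNorm_sub_le hp (ε := ENNReal.ofReal (ε / 2))
    (by simpa using hε)
  have h : g.toContinuousMap ∈ (Submodule.span ℂ (Set.range
      (mFourier (d := Fin d)))).topologicalClosure := by
    rw [span_mFourier_closure_eq_top]; trivial
  obtain ⟨y, hy, hyg⟩ := Metric.mem_closure_iff.mp h (ε / 2) (by positivity)
  obtain ⟨c, rfl⟩ : ∃ c, Finsupp.linearCombination ℂ (mFourier (d := Fin d)) c = y := by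
    rw [← LinearMap.mem_range, Finsupp.range_linearCombination]; exact hy
  refine ⟨c.support, c, ?_⟩
  have hc : (fun x => ∑ k ∈ c.support, c k * mFourier k x) =
      ⇑(Finsupp.linearCombination ℂ (mFourier (d := Fin d)) c) := by
    ext x
    simp [Finsupp.linearCombination_apply, Finsupp.sum, ContinuousMap.sum_apply]
  rw [hc]
  set y := Finsupp.linearCombination ℂ (mFourier (d := Fin d)) c
  have : f - ⇑y = (f - ⇑g) + (⇑g - ⇑y) := by ring
  rw [this]
  refine (eLpNorm_add_le (hf.aestronglyMeasurable.sub g.continuous.aestronglyMeasurable)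
    (g.continuous.aestronglyMeasurable.sub y.continuous.aestronglyMeasurable) hp1).trans ?_
  refine (add_le_add hg (eLpNorm_le_ofReal (M := ε / 2) p fun x => ?_)).trans ?_
  · rw [dist_eq_norm] at hyg
    exact (ContinuousMap.norm_coe_le_norm (g.toContinuousMap - y) x).trans hyg.le
  · rw [← ENNReal.ofReal_add (by positivity) (by positivity), add_halves]

lemma exists_eLpNorm_fourierSum_le_of_le_two (d : ℕ) {p : ℝ} (hp : 1 < p) (hp2 : p ≤ 2) :
    ∃ K : ℝ≥0, ∀ (n : Fin d → ℕ) (f : UnitAddTorus (Fin d) → ℂ),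
      MemLp f (ENNReal.ofReal p) (torusMeasure d) →
      eLpNorm (fourierSum n f) (ENNReal.ofReal p) (torusMeasure d) ≤
        K * eLpNorm f (ENNReal.ofReal p) (torusMeasure d) := by
  obtain ⟨K, hK⟩ := exists_eLpNorm_sum_filter_box_le d hp hp2
  refine ⟨K, fun n f hf => ?_⟩
  set P := ENNReal.ofReal p with hP
  have hP1 : 1 ≤ P := by rw [hP]; simpa using hp.le
  refine ennreal_le_of_forall_pos_le_add_mul (M := (box n).card + K) (by simp) fun ε hε => ?_
  obtain ⟨s, a, hsa⟩ := exists_eLpNorm_sub_sum_mFourier_le ENNReal.ofReal_ne_top hf hε hP1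
  set g : UnitAddTorus (Fin d) → ℂ := fun x => ∑ k ∈ s, a k * mFourier k x with hg
  have hgc : Continuous g := by rw [hg]; fun_prop
  have hfg : MemLp (f - g) P (torusMeasure d) := hf.sub (memLp_of_continuous hgc _)
  have hsum : fourierSum n f = fourierSum n (f - g) + fourierSum n g := by
    rw [← fourierSum_add (hfg.integrable hP1) (integrable_of_continuous hgc), sub_add_cancel]
  have h1 : eLpNorm (fourierSum n (f - g)) P (torusMeasure d) ≤
      (box n).card * ENNReal.ofReal ε := by
    refine (eLpNorm_le_of_ae_enorm_bound (C := (box n).card * ENNReal.ofReal ε)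
      (ae_of_all _ fun x => (enorm_fourierSum_le n _ x).trans ?_)).trans ?_
    · gcongr
      exact (eLpNorm_le_eLpNorm_of_exponent_le hP1 hfg.aestronglyMeasurable).trans hsa
    · simp
  have h2 : eLpNorm g P (torusMeasure d) ≤ eLpNorm f P (torusMeasure d) + ENNReal.ofReal ε := by
    have : g = f - (f - g) := by ring
    rw [this]
    exact (eLpNorm_sub_le hf.aestronglyMeasurable hfg.aestronglyMeasurable hP1).trans
      (add_le_add le_rfl hsa)
  have h3 : eLpNorm (fourierSum n g) P (torusMeasure d) ≤ K * eLpNorm g P (torusMeasure d) := by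
    rw [hg, fourierSum_mFourier_sum]
    exact hK n s a
  rw [hsum]
  refine (eLpNorm_add_le (continuous_fourierSum _ _).aestronglyMeasurable
    (continuous_fourierSum _ _).aestronglyMeasurable hP1).trans ?_
  refine (add_le_add h1 (h3.trans (mul_le_mul_right h2 _))).trans (le_of_eq ?_)
  ring

/-! ### Duality and convergence for scalar functions -/

/-- The partial sum operator is symmetric for the bilinear pairing, as `box n` is symmetric. -/
lemma integral_fourierSum_mul (n : Fin d → ℕ) {f g : UnitAddTorus (Fin d) → ℂ}
    (hf : Integrable f (torusMeasure d)) (hg : Integrable g (torusMeasure d)) :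
    ∫ x, fourierSum n f x * g x ∂torusMeasure d = ∫ x, f x * fourierSum n g x ∂torusMeasure d := by
  have h1 : ∫ x, fourierSum n f x * g x ∂torusMeasure d =
      ∑ k ∈ box n, mFourierCoeff f k * mFourierCoeff g (-k) := by
    simp only [fourierSum, Finset.sum_mul, mul_assoc]
    rw [integral_finsetSum _ fun k _ => (integrable_mFourier_mul k hg).const_mul _]
    refine Finset.sum_congr rfl fun k _ => ?_
    rw [integral_const_mul, mFourierCoeff_eq g, neg_neg]
  have h2 : ∫ x, f x * fourierSum n g x ∂torusMeasure d =
      ∑ k ∈ box n, mFourierCoeff g k * mFourierCoeff f (-k) := by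
    simp only [fourierSum, Finset.mul_sum]
    have : ∀ k x, f x * (mFourierCoeff g k * mFourier k x) =
        mFourierCoeff g k * (mFourier k x * f x) := fun k x => by ring
    simp only [this]
    rw [integral_finsetSum _ fun k _ => (integrable_mFourier_mul k hf).const_mul _]
    refine Finset.sum_congr rfl fun k _ => ?_
    rw [integral_const_mul, mFourierCoeff_eq f, neg_neg]
  rw [h1, h2]
  refine Finset.sum_nbij' (fun k => -k) (fun k => -k) ?_ ?_ ?_ ?_ ?_
  · simp [mem_box]
  · simp [mem_box]
  · simp
  · simp
  · intro k _
    rw [neg_neg, mul_comm]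

/-- Uniform `L^q` boundedness of the scalar rectangular partial sums. For `q > 2` it follows from the
conjugate exponent: `‖h‖_q ^ q` with `h = fourierSum n f` is the pairing of `h` with
`conj h * |h| ^ (q - 2)`, and the partial sum can be moved to the other factor. -/
lemma exists_eLpNorm_fourierSum_le (d : ℕ) {q : ℝ} (hq : 1 < q) :
    ∃ K : ℝ≥0, ∀ (n : Fin d → ℕ) (f : UnitAddTorus (Fin d) → ℂ),
      MemLp f (ENNReal.ofReal q) (torusMeasure d) →
      eLpNorm (fourierSum n f) (ENNReal.ofReal q) (torusMeasure d) ≤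
        K * eLpNorm f (ENNReal.ofReal q) (torusMeasure d) := by
  rcases le_or_gt q 2 with hq2 | hq2
  · exact exists_eLpNorm_fourierSum_le_of_le_two d hq hq2
  set p := q.conjExponent with hpdef
  have hpq : q.HolderConjugate p := Real.HolderConjugate.conjExponent hq
  have hp : 1 < p := hpq.symm.lt
  have hp2 : p ≤ 2 := by
    rw [hpdef, Real.conjExponent, div_le_iff₀ (by linarith)]
    linarith
  have hq0 : 0 < q := by linarith
  have hp0 : 0 < p := by linarith
  obtain ⟨K, hK⟩ := exists_eLpNorm_fourierSum_le_of_le_two d hp hp2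
  refine ⟨K, fun n f hf => ?_⟩
  set h := fourierSum n f with hh
  have hc : Continuous h := continuous_fourierSum n f
  set g : UnitAddTorus (Fin d) → ℂ := fun x => conj (h x) * ((‖h x‖ ^ (q - 2) : ℝ) : ℂ) with hg
  have hgc : Continuous g := by
    refine (Complex.continuous_conj.comp hc).mul (Complex.continuous_ofReal.comp ?_)
    exact hc.norm.rpow_const fun _ => Or.inr (by linarith)
  have hqq : ∀ x, h x * g x = ((‖h x‖ ^ q : ℝ) : ℂ) := by
    intro x
    rw [hg]
    simp only
    rw [← mul_assoc, Complex.mul_conj, Complex.normSq_eq_norm_sq, ← Complex.ofReal_mul,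
      ← Real.rpow_natCast, ← Real.rpow_add_of_nonneg (norm_nonneg _) (by norm_num) (by linarith)]
    congr 2
    push_cast
    ring
  have hgn : ∀ x, ‖g x‖ₑ ^ p = ‖h x‖ₑ ^ q := by
    intro x
    have h1 : ‖g x‖ = ‖h x‖ ^ (q - 1) := by
      simp only [hg, norm_mul, RCLike.norm_conj, Complex.norm_real, Real.norm_eq_abs]
      rw [abs_of_nonneg (by positivity)]
      nth_rw 1 [← Real.rpow_one ‖h x‖]
      rw [← Real.rpow_add_of_nonneg (norm_nonneg _) (by norm_num) (by linarith)]
      congr 1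
      ring
    rw [← ofReal_norm, ← ofReal_norm, h1,
      ENNReal.ofReal_rpow_of_nonneg (by positivity) hp0.le,
      ENNReal.ofReal_rpow_of_nonneg (by positivity) hq0.le, ← Real.rpow_mul (norm_nonneg _)]
    congr 2
    rw [hpdef, Real.conjExponent]
    field_simp [(by linarith : q - 1 ≠ 0)]
  have hgp : MemLp g (ENNReal.ofReal p) (torusMeasure d) := memLp_of_continuous hgc _
  set X := ∫⁻ x, ‖h x‖ₑ ^ q ∂torusMeasure d with hX
  have hXtop : X ≠ ∞ := by
    rw [hX, ← eLpNorm_rpow_eq hq0]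
    exact ENNReal.rpow_ne_top_of_nonneg hq0.le (memLp_of_continuous hc _).eLpNorm_ne_top
  have hgX : eLpNorm g (ENNReal.ofReal p) (torusMeasure d) = X ^ (1 / p) := by
    rw [eLpNorm_ofReal_eq hp0]
    simp only [hgn, hX]
  have hXle : X ≤ eLpNorm f (ENNReal.ofReal q) (torusMeasure d) * (K * X ^ (1 / p)) := by
    have hf1 : Integrable f (torusMeasure d) := hf.integrable (by simpa using hq.le)
    have e1 : X = ‖∫ x, h x * g x ∂torusMeasure d‖ₑ := by
      simp only [hqq]
      rw [integral_complex_ofReal, ← ofReal_norm, Complex.norm_real,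
        Real.norm_of_nonneg (integral_nonneg fun x => by positivity),
        ofReal_integral_eq_lintegral_ofReal]
      · refine lintegral_congr fun x => ?_
        rw [← ofReal_norm, ENNReal.ofReal_rpow_of_nonneg (norm_nonneg _) hq0.le]
      · exact integrable_of_continuous (hc.norm.rpow_const fun _ => Or.inr hq0.le)
      · exact ae_of_all _ fun x => by positivity
    refine e1.trans_le ?_
    rw [hh, integral_fourierSum_mul n hf1 (integrable_of_continuous hgc)]
    refine (enorm_integral_le_lintegral_enorm _).trans ?_
    simp only [enorm_mul]
    refine (ENNReal.lintegral_mul_le_Lp_mul_Lq _ hpq hf.aestronglyMeasurable.enorm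
      (continuous_fourierSum n g).aestronglyMeasurable.enorm).trans ?_
    rw [← eLpNorm_ofReal_eq hq0, ← eLpNorm_ofReal_eq hp0, ← hgX]
    exact mul_le_mul_right (hK n g hgp) _
  rw [eLpNorm_ofReal_eq hq0, ← hX]
  -- Dividing `hXle` by `X ^ (1 / p)` needs `X` to be neither `0` nor `∞`.
  by_cases hX0 : X = 0
  · rw [hX0, ENNReal.zero_rpow_of_pos (by positivity)]
    exact zero_le
  have hne : X ^ (1 / p) ≠ 0 := by
    simp [ENNReal.rpow_eq_zero_iff, hX0, hXtop]
  have hnt : X ^ (1 / p) ≠ ∞ := ENNReal.rpow_ne_top_of_nonneg (by positivity) hXtop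
  rw [← ENNReal.mul_le_mul_iff_left hne hnt, ← ENNReal.rpow_add _ _ hX0 hXtop]
  have hsum : 1 / q + 1 / p = 1 := by
    have := hpq.inv_add_inv_eq_one
    simpa using this
  rw [hsum, ENNReal.rpow_one]
  refine hXle.trans (le_of_eq ?_)
  ring

lemma eventually_mem_box (hd : 1 ≤ d) (k : Fin d → ℤ) :
    ∀ᶠ n : Fin d → ℕ in comap minIndex atTop, k ∈ box n := by
  have : Nonempty (Fin d) := ⟨⟨0, hd⟩⟩
  have h := (eventually_ge_atTop (∑ j, (k j).natAbs)).comap (minIndex (d := d))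
  filter_upwards [h] with n hn
  rw [mem_box]
  intro j
  have h1 : minIndex n ≤ n j := ciInf_le (OrderBot.bddBelow _) j
  have h2 : (k j).natAbs ≤ ∑ j, (k j).natAbs :=
    Finset.single_le_sum (f := fun j => (k j).natAbs) (fun _ _ => Nat.zero_le _)
      (Finset.mem_univ j)
  have h3 : (k j).natAbs ≤ n j := h2.trans (hn.trans h1)
  rw [Int.abs_eq_natAbs]
  exact_mod_cast h3

lemma tendsto_eLpNorm_fourierSum_sub (hd : 1 ≤ d) {q : ℝ} (hq : 1 < q)
    {f : UnitAddTorus (Fin d) → ℂ} (hf : MemLp f (ENNReal.ofReal q) (torusMeasure d)) :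
    Tendsto (fun n : Fin d → ℕ => eLpNorm (fourierSum n f - f) (ENNReal.ofReal q) (torusMeasure d))
      (comap minIndex atTop) (𝓝 0) := by
  obtain ⟨K, hK⟩ := exists_eLpNorm_fourierSum_le d hq
  set Q := ENNReal.ofReal q with hQ
  have hQ1 : 1 ≤ Q := by rw [hQ]; simpa using hq.le
  rw [ENNReal.tendsto_nhds_zero]
  intro ε hε
  obtain ⟨δ, hδ0, hδ⟩ : ∃ δ : ℝ, 0 < δ ∧ (K + 1) * ENNReal.ofReal δ ≤ ε := by
    have ht : Tendsto (fun δ : ℝ => ((K : ℝ≥0∞) + 1) * ENNReal.ofReal δ) (𝓝[>] 0)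
        (𝓝 (((K : ℝ≥0∞) + 1) * 0)) := by
      refine ENNReal.Tendsto.const_mul ?_ (Or.inr (by simp))
      have := (ENNReal.continuous_ofReal.tendsto 0).mono_left
        (nhdsWithin_le_nhds (s := Set.Ioi (0 : ℝ)))
      simpa using this
    rw [mul_zero] at ht
    obtain ⟨δ, h1, h2⟩ := ((ht.eventually_le_const hε).and self_mem_nhdsWithin).exists
    exact ⟨δ, h2, h1⟩
  obtain ⟨s, a, hsa⟩ := exists_eLpNorm_sub_sum_mFourier_le ENNReal.ofReal_ne_top hf hδ0 hQ1
  set g : UnitAddTorus (Fin d) → ℂ := fun x => ∑ k ∈ s, a k * mFourier k x with hg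
  have hgc : Continuous g := by rw [hg]; fun_prop
  have hfg : MemLp (f - g) Q (torusMeasure d) := hf.sub (memLp_of_continuous hgc _)
  have hev : ∀ᶠ n : Fin d → ℕ in comap minIndex atTop, ∀ k ∈ s, k ∈ box n :=
    (Filter.eventually_all_finset s).mpr fun k _ => eventually_mem_box hd k
  filter_upwards [hev] with n hn
  have hgn : fourierSum n g = g := by
    rw [hg, fourierSum_mFourier_sum, Finset.filter_true_of_mem hn]
  have hsum : fourierSum n f - f = fourierSum n (f - g) - (f - g) := by
    have : fourierSum n f = fourierSum n (f - g) + fourierSum n g := by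
      rw [← fourierSum_add (hfg.integrable hQ1) (integrable_of_continuous hgc), sub_add_cancel]
    rw [this, hgn]
    ring
  rw [hsum]
  refine (eLpNorm_sub_le (continuous_fourierSum _ _).aestronglyMeasurable hfg.aestronglyMeasurable
    hQ1).trans ?_
  refine (add_le_add ((hK n _ hfg).trans (mul_le_mul_right hsa _)) hsa).trans ?_
  refine le_trans (le_of_eq ?_) hδ
  ring

/-! ### Square functions of finite families -/

/-- By rotation invariance, the mean of `|⟪z, v⟫| ^ q` over the unit ball is a constant multiple of
`|v| ^ q`. -/
lemma exists_lintegral_ball_inner_rpow (E : Type*) [NormedAddCommGroup E] [InnerProductSpace ℝ E]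
    [FiniteDimensional ℝ E] [MeasurableSpace E] [BorelSpace E] {q : ℝ} (hq : 0 < q) :
    ∃ κ : ℝ≥0∞, κ ≠ 0 ∧ κ ≠ ∞ ∧ ∀ v : E,
      ∫⁻ z in Metric.ball (0 : E) 1, ‖inner ℝ z v‖ₑ ^ q = κ * ‖v‖ₑ ^ q := by
  cases subsingleton_or_nontrivial E with
  | inl h =>
    refine ⟨1, one_ne_zero, ENNReal.one_ne_top, fun v => ?_⟩
    rw [Subsingleton.elim v 0]
    simp [hq]
  | inr h =>
    obtain ⟨e, he⟩ := exists_norm_eq E zero_le_one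
    set φ : E → E → ℝ≥0∞ := fun v z => ‖inner ℝ z v‖ₑ ^ q with hφ
    have hφc : ∀ v, Continuous (φ v) := fun v => by
      simp only [hφ]
      fun_prop
    refine ⟨∫⁻ z in Metric.ball (0 : E) 1, φ e z, ?_, ?_, fun v => ?_⟩
    · rw [← pos_iff_ne_zero, setLIntegral_pos_iff (hφc e).measurable]
      have hopen : IsOpen (Function.support (φ e) ∩ Metric.ball 0 1) := by
        refine IsOpen.inter ?_ Metric.isOpen_ball
        exact (hφc e).isOpen_support
      refine hopen.measure_pos _ ⟨(1 / 2 : ℝ) • e, ?_, ?_⟩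
      · simp [hφ, hq, inner_smul_left, he]
      · simp [norm_smul, he]
        norm_num
    · refine ne_of_lt ?_
      calc ∫⁻ z in Metric.ball (0 : E) 1, φ e z
          ≤ ∫⁻ z in Metric.ball (0 : E) 1, 1 := by
            refine setLIntegral_mono measurable_const fun z hz => ?_
            refine ENNReal.rpow_le_one ?_ hq.le
            rw [← ofReal_norm, ENNReal.ofReal_le_one]
            refine (norm_inner_le_norm z e).trans ?_
            rw [he, mul_one]
            exact (mem_ball_zero_iff.mp hz).le
        _ < ∞ := by
            rw [setLIntegral_one]
            exact measure_ball_lt_top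
    -- A reflection that takes `‖v‖ • e` to `v`.
    · set R : E ≃ₗᵢ[ℝ] E := (ℝ ∙ (‖v‖ • e - v))ᗮ.reflection with hR
      have hRv : R (‖v‖ • e) = v := by
        rw [hR]
        refine Submodule.reflection_sub ?_
        rw [norm_smul, he, norm_norm, mul_one]
      have hball : R ⁻¹' Metric.ball 0 1 = Metric.ball 0 1 := by
        ext z
        simp
      have := R.measurePreserving.setLIntegral_comp_preimage
        (measurableSet_ball (x := (0 : E)) (ε := 1)) (hφc v).measurable
      rw [hball] at this
      change ∫⁻ z in Metric.ball (0 : E) 1, φ v z = _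
      rw [← this, mul_comm, ← lintegral_const_mul _ (hφc e).measurable]
      refine lintegral_congr fun z => ?_
      simp only [hφ]
      rw [← hRv, R.inner_map_map, inner_smul_right, enorm_mul, hRv, enorm_norm,
        ENNReal.mul_rpow_of_nonneg _ _ hq.le]

/-- On real functions, the kernel definition and the Fourier coefficient definition agree. -/
lemma ofReal_partialSum (n : Fin d → ℕ) {f : UnitAddTorus (Fin d) → ℝ}
    (hf : Integrable f (torusMeasure d)) (x : UnitAddTorus (Fin d)) :
    ((partialSum n f x : ℝ) : ℂ) = fourierSum n (fun y => (f y : ℂ)) x :=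
  apply_partialSum n f hf (ContinuousLinearMap.id ℝ ℝ) x

/-- The Marcinkiewicz–Zygmund argument: a scalar bound extends to square functions with the same
constant. One applies the scalar bound to every combination `∑ z i * f i` and averages over `z` in
the unit ball of a Euclidean space. -/
lemma lintegral_sum_sq_partialSum_le {q : ℝ} (hq : 1 < q) {K : ℝ≥0}
    (hK : ∀ (n : Fin d → ℕ) (f : UnitAddTorus (Fin d) → ℂ),
      MemLp f (ENNReal.ofReal q) (torusMeasure d) →
      eLpNorm (fourierSum n f) (ENNReal.ofReal q) (torusMeasure d) ≤
        K * eLpNorm f (ENNReal.ofReal q) (torusMeasure d))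
    {I : Type*} (s : Finset I) (f : I → UnitAddTorus (Fin d) → ℝ)
    (hf : ∀ i, MemLp (f i) (ENNReal.ofReal q) (torusMeasure d)) (n : Fin d → ℕ) :
    ∫⁻ x, (∑ i ∈ s, ‖partialSum n (f i) x‖ₑ ^ 2) ^ (q / 2) ∂torusMeasure d ≤
      (K : ℝ≥0∞) ^ q * ∫⁻ x, (∑ i ∈ s, ‖f i x‖ₑ ^ 2) ^ (q / 2) ∂torusMeasure d := by
  have hq0 : 0 < q := by linarith
  have hint : ∀ i, Integrable (f i) (torusMeasure d) := fun i =>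
    (hf i).integrable (by simpa using hq.le)
  obtain ⟨κ, hκ0, hκt, hκ⟩ := exists_lintegral_ball_inner_rpow (EuclideanSpace ℝ s) hq0
  set ν : Measure (EuclideanSpace ℝ s) := volume.restrict (Metric.ball 0 1) with hν
  have hnorm : ∀ v : I → ℝ, (∑ i ∈ s, ‖v i‖ₑ ^ 2) ^ (q / 2) =
      ‖(WithLp.toLp 2 fun i : s => v i : EuclideanSpace ℝ s)‖ₑ ^ q := by
    intro v
    have h2 : (∑ i ∈ s, ‖v i‖ₑ ^ 2) =
        ‖(WithLp.toLp 2 fun i : s => v i : EuclideanSpace ℝ s)‖ₑ ^ (2 : ℝ) := by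
      rw [ENNReal.rpow_ofNat, ← ofReal_norm, ← ENNReal.ofReal_pow (norm_nonneg _),
        EuclideanSpace.norm_sq_eq, ENNReal.ofReal_sum_of_nonneg fun i _ => by positivity]
      simp only [ENNReal.ofReal_pow (norm_nonneg _), ofReal_norm]
      rw [← Finset.sum_coe_sort s]
    rw [h2, ← ENNReal.rpow_mul, mul_div_cancel₀ _ two_ne_zero]
  have hinner : ∀ (v : I → ℝ) (z : EuclideanSpace ℝ s),
      inner ℝ z (WithLp.toLp 2 fun i : s => v i : EuclideanSpace ℝ s) = ∑ i : s, z i * v i := by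
    intro v z
    rw [PiLp.inner_apply]
    refine Finset.sum_congr rfl fun i _ => ?_
    simp [mul_comm]
  have hpol : ∀ v : I → ℝ, κ * (∑ i ∈ s, ‖v i‖ₑ ^ 2) ^ (q / 2) =
      ∫⁻ z, ‖∑ i : s, z i * v i‖ₑ ^ q ∂ν := by
    intro v
    rw [hnorm, ← hκ]
    simp only [hinner, hν]
  have hswap : ∀ g : I → UnitAddTorus (Fin d) → ℝ,
      (∀ i, AEStronglyMeasurable (g i) (torusMeasure d)) →
      κ * ∫⁻ x, (∑ i ∈ s, ‖g i x‖ₑ ^ 2) ^ (q / 2) ∂torusMeasure d =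
        ∫⁻ z, ∫⁻ x, ‖∑ i : s, z i * g i x‖ₑ ^ q ∂torusMeasure d ∂ν := by
    intro g hg
    rw [← lintegral_const_mul' _ _ hκt]
    simp only [fun x => hpol fun i => g i x]
    refine lintegral_lintegral_swap ?_
    have : AEMeasurable (fun p : UnitAddTorus (Fin d) × EuclideanSpace ℝ s =>
        ∑ i : s, p.2 i * g i p.1) ((torusMeasure d).prod ν) := by
      refine Finset.aemeasurable_fun_sum _ fun i _ => ?_
      refine AEMeasurable.mul ?_ ((hg i).comp_fst (ν := ν)).aemeasurable
      refine Continuous.aemeasurable ?_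
      fun_prop
    exact this.enorm.pow_const q
  have hTc : ∀ i, AEStronglyMeasurable (partialSum n (f i)) (torusMeasure d) := by
    intro i
    have h1 : partialSum n (f i) = fun x => (fourierSum n (fun y => (f i y : ℂ)) x).re := by
      ext x
      rw [← ofReal_partialSum n (hint i), Complex.ofReal_re]
    rw [h1]
    exact (Complex.continuous_re.comp (continuous_fourierSum _ _)).aestronglyMeasurable
  rw [← ENNReal.mul_le_mul_iff_right hκ0 hκt, hswap _ hTc, mul_left_comm, hswap _ fun i =>
    (hf i).aestronglyMeasurable, ← lintegral_const_mul' _ _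
      (ENNReal.rpow_ne_top_of_nonneg hq0.le ENNReal.coe_ne_top)]
  refine lintegral_mono fun z => ?_
  have hF : MemLp (fun x => ∑ i : s, (z i : ℂ) * (f i x : ℂ)) (ENNReal.ofReal q)
      (torusMeasure d) := memLp_finsetSum _ fun i _ => (hf i).ofReal.const_mul _
  have h1 := hK n _ hF
  rw [← ENNReal.rpow_le_rpow_iff hq0, ENNReal.mul_rpow_of_nonneg _ _ hq0.le, eLpNorm_rpow_eq hq0,
    eLpNorm_rpow_eq hq0] at h1
  have hreal : ∀ r : ℝ, ‖(r : ℂ)‖ₑ = ‖r‖ₑ := fun r => by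
    rw [← ofReal_norm, Complex.norm_real, ofReal_norm]
  convert h1 using 4 with x x
  · rw [fourierSum_sum_const_mul _ (fun i : s => (z i : ℂ)) (fun (i : s) y => (f i y : ℂ))
      fun i _ => (hint i).ofReal]
    simp only [← ofReal_partialSum n (hint _), ← Complex.ofReal_mul, ← Complex.ofReal_sum, hreal]
  · simp only [← Complex.ofReal_mul, ← Complex.ofReal_sum, hreal]

/-! ### Partial sums of vector functions and countable families -/

lemma exists_norm_dirichletKernel_re_le (n : Fin d → ℕ) :
    ∃ M : ℝ, ∀ u, ‖(dirichletKernel n u).re‖ ≤ M := by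
  refine ⟨∑ k ∈ box n, ‖UnitAddTorus.mFourier k‖, fun u => ?_⟩
  refine (Complex.abs_re_le_norm _).trans ((norm_sum_le _ _).trans ?_)
  exact Finset.sum_le_sum fun k _ => (UnitAddTorus.mFourier k).norm_coe_le_norm u

lemma continuous_dirichletKernel_re (n : Fin d → ℕ) :
    Continuous fun u => (dirichletKernel n u).re := by
  refine Complex.continuous_re.comp ?_
  unfold dirichletKernel
  fun_prop

section

variable {Y : Type*} [NormedAddCommGroup Y] [NormedSpace ℝ Y]

lemma partialSum_eq_integral_sub (n : Fin d → ℕ) (g : UnitAddTorus (Fin d) → Y)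
    (x : UnitAddTorus (Fin d)) :
    partialSum n g x = ∫ u, (dirichletKernel n (x - u)).re • g u ∂torusMeasure d := by
  unfold partialSum
  rw [← integral_sub_left_eq_self _ (torusMeasure d) x]
  simp only [sub_sub_cancel]

lemma continuous_partialSum (n : Fin d → ℕ) {g : UnitAddTorus (Fin d) → Y}
    (hg : Integrable g (torusMeasure d)) : Continuous (partialSum n g) := by
  obtain ⟨M, hM⟩ := exists_norm_dirichletKernel_re_le n
  have h : partialSum n g = fun x => ∫ u, (dirichletKernel n (x - u)).re • g u ∂torusMeasure d :=
    funext fun x => partialSum_eq_integral_sub n g x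
  rw [h]
  refine continuous_of_dominated (bound := fun u => M * ‖g u‖) (fun x => ?_) (fun x => ?_)
    (hg.norm.const_mul M) (ae_of_all _ fun u => ?_)
  · exact ((continuous_dirichletKernel_re n).comp
      (continuous_const.sub continuous_id)).aestronglyMeasurable.smul hg.aestronglyMeasurable
  · refine ae_of_all _ fun u => ?_
    rw [norm_smul]
    gcongr
    exact hM _
  · exact ((continuous_dirichletKernel_re n).comp
      (continuous_id.sub continuous_const)).smul continuous_const

lemma exists_enorm_partialSum_le (n : Fin d → ℕ) :
    ∃ M : ℝ≥0, ∀ (g : UnitAddTorus (Fin d) → Y) (x : UnitAddTorus (Fin d)),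
      ‖partialSum n g x‖ₑ ≤ M * ∫⁻ u, ‖g u‖ₑ ∂torusMeasure d := by
  obtain ⟨M, hM⟩ := exists_norm_dirichletKernel_re_le n
  refine ⟨M.toNNReal, fun g x => ?_⟩
  rw [partialSum_eq_integral_sub, ← lintegral_const_mul' _ _ ENNReal.coe_ne_top]
  refine (enorm_integral_le_lintegral_enorm _).trans (lintegral_mono fun u => ?_)
  rw [enorm_smul]
  gcongr
  rw [← ofReal_norm]
  exact ENNReal.ofReal_le_ofReal (hM _)

lemma clm_apply_partialSum [CompleteSpace Y] (n : Fin d → ℕ) {g : UnitAddTorus (Fin d) → Y}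
    (hg : Integrable g (torusMeasure d)) (ℓ : Y →L[ℝ] ℝ) (x : UnitAddTorus (Fin d)) :
    ℓ (partialSum n g x) = partialSum n (fun y => ℓ (g y)) x := by
  have h1 := apply_partialSum n g hg ℓ x
  have h2 := ofReal_partialSum n (ℓ.integrable_comp hg) x
  exact Complex.ofReal_injective (h1.trans h2.symm)

end

lemma ennreal_iSup_rpow {I : Type*} (g : I → ℝ≥0∞) {r : ℝ} (hr : 0 < r) :
    (⨆ i, g i) ^ r = ⨆ i, g i ^ r := (ENNReal.orderIsoRpow r hr).map_iSup g

lemma lintegral_tsum_sq_partialSum_le {q : ℝ} (hq : 1 < q) {K : ℝ≥0}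
    (hK : ∀ (n : Fin d → ℕ) (f : UnitAddTorus (Fin d) → ℂ),
      MemLp f (ENNReal.ofReal q) (torusMeasure d) →
      eLpNorm (fourierSum n f) (ENNReal.ofReal q) (torusMeasure d) ≤
        K * eLpNorm f (ENNReal.ofReal q) (torusMeasure d))
    {I : Type*} [Countable I] (f : I → UnitAddTorus (Fin d) → ℝ)
    (hf : ∀ i, MemLp (f i) (ENNReal.ofReal q) (torusMeasure d)) (n : Fin d → ℕ) :
    ∫⁻ x, (∑' i, ‖partialSum n (f i) x‖ₑ ^ 2) ^ (q / 2) ∂torusMeasure d ≤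
      (K : ℝ≥0∞) ^ q * ∫⁻ x, (∑' i, ‖f i x‖ₑ ^ 2) ^ (q / 2) ∂torusMeasure d := by
  have hq0 : 0 < q / 2 := by linarith
  have hint : ∀ i, Integrable (f i) (torusMeasure d) := fun i =>
    (hf i).integrable (by simpa using hq.le)
  simp only [ENNReal.tsum_eq_iSup_sum (f := fun i => ‖partialSum n (f i) _‖ₑ ^ 2),
    ennreal_iSup_rpow _ hq0]
  rw [lintegral_iSup_directed]
  · refine iSup_le fun s => (lintegral_sum_sq_partialSum_le hq hK s f hf n).trans ?_
    gcongr with x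
    exact ENNReal.sum_le_tsum s
  · intro s
    refine (Finset.aemeasurable_fun_sum _ fun i _ => ?_).pow_const _
    exact (continuous_partialSum n (hint i)).aestronglyMeasurable.enorm.pow_const 2
  · refine Monotone.directed_le fun s t hst x => ?_
    exact ENNReal.rpow_le_rpow (Finset.sum_le_sum_of_subset hst) hq0.le

lemma ennreal_add_rpow_le (a b : ℝ≥0∞) {r : ℝ} (hr : 0 ≤ r) :
    (a + b) ^ r ≤ 2 ^ r * (a ^ r + b ^ r) := by
  have h : a + b ≤ 2 * max a b := by
    rw [two_mul]; exact add_le_add (le_max_left _ _) (le_max_right _ _)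
  refine (ENNReal.rpow_le_rpow h hr).trans ?_
  rw [ENNReal.mul_rpow_of_nonneg _ _ hr]
  gcongr
  rcases le_total a b with hab | hab
  · rw [max_eq_right hab]; exact le_add_self
  · rw [max_eq_left hab]; exact le_self_add

lemma ennreal_sum_rpow_le {I : Type*} (s : Finset I) (a : I → ℝ≥0∞) {r : ℝ} (hr : 0 < r) :
    (∑ i ∈ s, a i) ^ r ≤ (s.card : ℝ≥0∞) ^ r * ∑ i ∈ s, a i ^ r := by
  rcases s.eq_empty_or_nonempty with rfl | hs
  · simp [hr]
  obtain ⟨j, hj, hmax⟩ := s.exists_max_image a hs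
  have h : ∑ i ∈ s, a i ≤ s.card * a j := by
    rw [← nsmul_eq_mul]
    exact Finset.sum_le_card_nsmul _ _ _ hmax
  refine (ENNReal.rpow_le_rpow h hr.le).trans ?_
  rw [ENNReal.mul_rpow_of_nonneg _ _ hr.le]
  gcongr
  exact Finset.single_le_sum (f := fun i => a i ^ r) (fun _ _ => zero_le) hj

lemma enorm_sub_sq_le {E : Type*} [NormedAddCommGroup E] (a b : E) :
    ‖a - b‖ₑ ^ 2 ≤ 4 * (‖a‖ₑ ^ 2 + ‖b‖ₑ ^ 2) := by
  have h1 := ennreal_add_rpow_le ‖a‖ₑ ‖b‖ₑ (r := 2) (by norm_num)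
  have h2 : ‖a - b‖ₑ ≤ ‖a‖ₑ + ‖b‖ₑ := enorm_sub_le
  simp only [ENNReal.rpow_ofNat] at h1
  calc ‖a - b‖ₑ ^ 2 ≤ (‖a‖ₑ + ‖b‖ₑ) ^ 2 := by gcongr
    _ ≤ _ := h1.trans (le_of_eq (by norm_num))

lemma ennreal_tsum_rpow_le {I : Type*} (s : Finset I) (a : I → ℝ≥0∞) {r : ℝ} (hr : 0 < r) :
    (∑' i, a i) ^ r ≤ 2 ^ r * ((s.card : ℝ≥0∞) ^ r * ∑ i ∈ s, a i ^ r) +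
      2 ^ r * (∑' i : {i // i ∉ s}, a i) ^ r := by
  have h : ∑' i, a i = ∑ i ∈ s, a i + ∑' i : {i // i ∉ s}, a i :=
    (ENNReal.sum_add_tsum_compl s a).symm
  rw [h, ← mul_add]
  exact (ennreal_add_rpow_le _ _ hr.le).trans
    (mul_le_mul_right (add_le_add (ennreal_sum_rpow_le s a hr) le_rfl) _)

lemma tsum_enorm_sub_sq_rpow_le {I : Type*} {E : Type*} [NormedAddCommGroup E] (a b : I → E)
    {r : ℝ} (hr : 0 ≤ r) :
    (∑' i, ‖a i - b i‖ₑ ^ 2) ^ r ≤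
      4 ^ r * 2 ^ r * ((∑' i, ‖a i‖ₑ ^ 2) ^ r + (∑' i, ‖b i‖ₑ ^ 2) ^ r) := by
  have h : ∑' i, ‖a i - b i‖ₑ ^ 2 ≤ 4 * (∑' i, ‖a i‖ₑ ^ 2 + ∑' i, ‖b i‖ₑ ^ 2) := by
    rw [← ENNReal.tsum_add, ← ENNReal.tsum_mul_left]
    exact ENNReal.tsum_le_tsum fun i => enorm_sub_sq_le _ _
  refine (ENNReal.rpow_le_rpow h hr).trans ?_
  rw [ENNReal.mul_rpow_of_nonneg _ _ hr, mul_assoc]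
  exact mul_le_mul_right (ennreal_add_rpow_le _ _ hr) _

lemma tendsto_lintegral_tsum_compl {q : ℝ} (hq : 0 < q) {I : Type*} [Countable I]
    (f : I → UnitAddTorus (Fin d) → ℝ)
    (hf : ∀ i, AEStronglyMeasurable (f i) (torusMeasure d))
    (hfin : ∫⁻ x, (∑' i, ‖f i x‖ₑ ^ 2) ^ (q / 2) ∂torusMeasure d ≠ ∞) :
    Tendsto (fun s : Finset I => ∫⁻ x, (∑' i : {i // i ∉ s}, ‖f i x‖ₑ ^ 2) ^ (q / 2)
      ∂torusMeasure d) atTop (𝓝 0) := by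
  have hq0 : 0 < q / 2 := by linarith
  have hm : ∀ {J : Type _} [Countable J] (g : J → I), AEMeasurable
      (fun x => (∑' j, ‖f (g j) x‖ₑ ^ 2) ^ (q / 2)) (torusMeasure d) := fun g =>
    (AEMeasurable.tsum fun j => (hf (g j)).enorm.pow_const 2).pow_const _
  have := tendsto_lintegral_filter_of_dominated_convergence' (μ := torusMeasure d)
    (l := (atTop : Filter (Finset I)))
    (F := fun s x => (∑' i : {i // i ∉ s}, ‖f i x‖ₑ ^ 2) ^ (q / 2)) (f := fun _ => 0)
    (fun x => (∑' i, ‖f i x‖ₑ ^ 2) ^ (q / 2)) ?_ ?_ hfin ?_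
  · simpa using this
  · exact Eventually.of_forall fun s => hm _
  · refine Eventually.of_forall fun s => ae_of_all _ fun x => ?_
    refine ENNReal.rpow_le_rpow ?_ hq0.le
    exact ENNReal.tsum_comp_le_tsum_of_injective Subtype.val_injective _
  · filter_upwards [ae_lt_top' (hm id) hfin] with x hx
    have hx' : ∑' i, ‖f i x‖ₑ ^ 2 ≠ ∞ := by
      intro h
      simp only [id, h, ENNReal.top_rpow_of_pos hq0] at hx
      exact lt_irrefl _ hx
    have := (ENNReal.tendsto_tsum_compl_atTop_zero hx').ennrpow_const (q / 2)
    rwa [ENNReal.zero_rpow_of_pos hq0] at this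

/-- Convergence of the partial sums in the square function norm. The members of a finite subfamily
converge one by one; the rest of the family has small norm, and so have its partial sums, by the
uniform bound. -/
lemma tendsto_lintegral_tsum_sq_partialSum_sub (hd : 1 ≤ d) {q : ℝ} (hq : 1 < q)
    {I : Type*} [Countable I] (f : I → UnitAddTorus (Fin d) → ℝ)
    (hf : ∀ i, MemLp (f i) (ENNReal.ofReal q) (torusMeasure d))
    (hfin : ∫⁻ x, (∑' i, ‖f i x‖ₑ ^ 2) ^ (q / 2) ∂torusMeasure d ≠ ∞) :
    Tendsto (fun n : Fin d → ℕ =>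
      ∫⁻ x, (∑' i, ‖partialSum n (f i) x - f i x‖ₑ ^ 2) ^ (q / 2) ∂torusMeasure d)
      (comap minIndex atTop) (𝓝 0) := by
  obtain ⟨K, hK⟩ := exists_eLpNorm_fourierSum_le d hq
  have hq0 : 0 < q := by linarith
  have hq20 : 0 < q / 2 := by linarith
  have hint : ∀ i, Integrable (f i) (torusMeasure d) := fun i =>
    (hf i).integrable (by simpa using hq.le)
  have hTm : ∀ n i, AEStronglyMeasurable (partialSum n (f i)) (torusMeasure d) := fun n i =>
    (continuous_partialSum n (hint i)).aestronglyMeasurable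
  have hreal : ∀ r : ℝ, ‖(r : ℂ)‖ₑ = ‖r‖ₑ := fun r => by
    rw [← ofReal_norm, Complex.norm_real, ofReal_norm]
  set r := q / 2 with hr
  have hscal : ∀ i, Tendsto (fun n : Fin d → ℕ =>
      ∫⁻ x, (‖partialSum n (f i) x - f i x‖ₑ ^ 2) ^ r ∂torusMeasure d)
      (comap minIndex atTop) (𝓝 0) := by
    intro i
    have := (tendsto_eLpNorm_fourierSum_sub hd hq (hf i).ofReal).ennrpow_const q
    rw [ENNReal.zero_rpow_of_pos hq0] at this
    refine this.congr fun n => ?_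
    rw [eLpNorm_rpow_eq hq0]
    refine lintegral_congr fun x => ?_
    rw [← ENNReal.rpow_ofNat, ← ENNReal.rpow_mul, hr, mul_div_cancel₀ _ two_ne_zero, ← hreal]
    simp only [Pi.sub_apply, Complex.ofReal_sub, ofReal_partialSum n (hint i)]
    rfl
  set c : ℝ≥0∞ := 2 ^ r * (4 ^ r * 2 ^ r * ((K : ℝ≥0∞) ^ q + 1)) with hc
  have hct : c ≠ ∞ := by
    have : ∀ m : ℕ, ((m : ℝ≥0∞)) ^ r ≠ ∞ := fun m =>
      ENNReal.rpow_ne_top_of_nonneg hq20.le (ENNReal.natCast_ne_top m)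
    have h2 : (2 : ℝ≥0∞) ^ r ≠ ∞ := this 2
    have h4 : (4 : ℝ≥0∞) ^ r ≠ ∞ := this 4
    have hKq : (K : ℝ≥0∞) ^ q + 1 ≠ ∞ := ENNReal.add_ne_top.mpr
      ⟨ENNReal.rpow_ne_top_of_nonneg hq0.le ENNReal.coe_ne_top, ENNReal.one_ne_top⟩
    exact ENNReal.mul_ne_top h2 (ENNReal.mul_ne_top (ENNReal.mul_ne_top h4 h2) hKq)
  have hmain : ∀ (s : Finset I) (n : Fin d → ℕ),
      ∫⁻ x, (∑' i, ‖partialSum n (f i) x - f i x‖ₑ ^ 2) ^ r ∂torusMeasure d ≤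
      2 ^ r * ((s.card : ℝ≥0∞) ^ r *
        ∑ i ∈ s, ∫⁻ x, (‖partialSum n (f i) x - f i x‖ₑ ^ 2) ^ r ∂torusMeasure d) +
      c * ∫⁻ x, (∑' i : {i // i ∉ s}, ‖f i x‖ₑ ^ 2) ^ r ∂torusMeasure d := by
    intro s n
    have hTle := lintegral_tsum_sq_partialSum_le hq hK (fun i : {i // i ∉ s} => f i)
      (fun i => hf i) n
    have hpt : ∀ x, (∑' i, ‖partialSum n (f i) x - f i x‖ₑ ^ 2) ^ r ≤
        2 ^ r * ((s.card : ℝ≥0∞) ^ r *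
          ∑ i ∈ s, (‖partialSum n (f i) x - f i x‖ₑ ^ 2) ^ r) +
        2 ^ r * (4 ^ r * 2 ^ r * ((∑' i : {i // i ∉ s}, ‖partialSum n (f i) x‖ₑ ^ 2) ^ r +
          (∑' i : {i // i ∉ s}, ‖f i x‖ₑ ^ 2) ^ r)) := by
      intro x
      exact (ennreal_tsum_rpow_le s _ hq20).trans (add_le_add le_rfl
        (mul_le_mul_right (tsum_enorm_sub_sq_rpow_le _ _ hq20.le) _))
    refine (lintegral_mono hpt).trans ?_
    have hm1 : ∀ i, AEMeasurable (fun x => (‖partialSum n (f i) x - f i x‖ₑ ^ 2) ^ r)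
        (torusMeasure d) := fun i =>
      (((hTm n i).sub (hf i).aestronglyMeasurable).enorm.pow_const 2).pow_const _
    have hm2 : AEMeasurable (fun x => (∑' i : {i // i ∉ s}, ‖f i x‖ₑ ^ 2) ^ r)
        (torusMeasure d) :=
      (AEMeasurable.tsum fun i : {i // i ∉ s} =>
        (hf i).aestronglyMeasurable.enorm.pow_const 2).pow_const _
    have hm3 : AEMeasurable (fun x => (∑' i : {i // i ∉ s}, ‖partialSum n (f i) x‖ₑ ^ 2) ^ r)
        (torusMeasure d) :=
      (AEMeasurable.tsum fun i : {i // i ∉ s} => (hTm n i).enorm.pow_const 2).pow_const _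
    have hm4 : AEMeasurable (fun x => (∑' i : {i // i ∉ s}, ‖partialSum n (f i) x‖ₑ ^ 2) ^ r +
        (∑' i : {i // i ∉ s}, ‖f i x‖ₑ ^ 2) ^ r) (torusMeasure d) := hm3.add hm2
    have hms : AEMeasurable (fun x => ∑ i ∈ s, (‖partialSum n (f i) x - f i x‖ₑ ^ 2) ^ r)
        (torusMeasure d) := Finset.aemeasurable_fun_sum _ fun i _ => hm1 i
    rw [lintegral_add_left' ((hms.const_mul _).const_mul _), lintegral_const_mul'' _
      (hms.const_mul _), lintegral_const_mul'' _ hms, lintegral_finsetSum' _ fun i _ => hm1 i,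
      lintegral_const_mul'' _ (hm4.const_mul _), lintegral_const_mul'' _ hm4,
      lintegral_add_left' hm3]
    refine add_le_add le_rfl ?_
    rw [hc, mul_assoc (2 ^ r), mul_assoc (4 ^ r * 2 ^ r), add_mul, one_mul]
    gcongr
  rw [ENNReal.tendsto_nhds_zero]
  intro ε hε
  have hε2 : 0 < ε / 2 := ENNReal.half_pos hε.ne'
  have htail := ENNReal.Tendsto.const_mul (a := c) (tendsto_lintegral_tsum_compl hq0 f
    (fun i => (hf i).aestronglyMeasurable) hfin) (Or.inr hct)
  rw [mul_zero] at htail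
  obtain ⟨s, hs⟩ := (htail.eventually_le_const hε2).exists
  have hhead : Tendsto (fun n : Fin d → ℕ => (2 : ℝ≥0∞) ^ r * ((s.card : ℝ≥0∞) ^ r *
      ∑ i ∈ s, ∫⁻ x, (‖partialSum n (f i) x - f i x‖ₑ ^ 2) ^ r ∂torusMeasure d))
      (comap minIndex atTop) (𝓝 0) := by
    have h1 := tendsto_finsetSum s fun i _ => hscal i
    rw [Finset.sum_const_zero] at h1
    have h2 := ENNReal.Tendsto.const_mul (a := (s.card : ℝ≥0∞) ^ r) h1
      (Or.inr (ENNReal.rpow_ne_top_of_nonneg hq20.le (ENNReal.natCast_ne_top _)))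
    rw [mul_zero] at h2
    have h3 := ENNReal.Tendsto.const_mul (a := (2 : ℝ≥0∞) ^ r) h2
      (Or.inr (ENNReal.rpow_ne_top_of_nonneg hq20.le (by simp)))
    rwa [mul_zero] at h3
  filter_upwards [hhead.eventually_le_const hε2] with n hn
  refine (hmain s n).trans ((add_le_add hn hs).trans ?_)
  rw [ENNReal.add_halves]

/-! ### Hilbert–Schmidt operators -/

/-- Minkowski's integral inequality for the `ℓ²` norm. -/
lemma tsum_sq_lintegral_le {α I : Type*} [MeasurableSpace α] {μ : Measure α}
    (a : I → α → ℝ≥0∞) (ha : ∀ i, AEMeasurable (a i) μ) (hfin : ∀ i, ∫⁻ x, a i x ∂μ ≠ ∞) :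
    ∑' i, (∫⁻ x, a i x ∂μ) ^ 2 ≤ (∫⁻ x, (∑' i, a i x ^ 2) ^ (1 / 2 : ℝ) ∂μ) ^ 2 := by
  rw [ENNReal.tsum_eq_iSup_sum]
  refine iSup_le fun s => ?_
  set b : I → ℝ≥0∞ := fun i => ∫⁻ x, a i x ∂μ
  set S := ∑ i ∈ s, b i ^ 2 with hS
  set T := ∫⁻ x, (∑' i, a i x ^ 2) ^ (1 / 2 : ℝ) ∂μ
  have hSt : S ≠ ∞ := ENNReal.sum_ne_top.mpr fun i _ => ENNReal.pow_ne_top (hfin i)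
  have hSr : S ^ (1 / 2 : ℝ) ≠ ∞ := ENNReal.rpow_ne_top_of_nonneg (by norm_num) hSt
  have hsq : S = S ^ (1 / 2 : ℝ) * S ^ (1 / 2 : ℝ) := by
    rw [← ENNReal.rpow_add_of_nonneg _ _ (by norm_num) (by norm_num)]
    norm_num
  have hle : S ≤ S ^ (1 / 2 : ℝ) * T := by
    calc S = ∑ i ∈ s, b i * ∫⁻ x, a i x ∂μ := by
          simp only [hS, sq]
          rfl
      _ = ∫⁻ x, ∑ i ∈ s, b i * a i x ∂μ := by
          rw [lintegral_finsetSum' _ fun i _ => (ha i).const_mul _]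
          refine Finset.sum_congr rfl fun i _ => ?_
          rw [lintegral_const_mul'' _ (ha i)]
      _ ≤ ∫⁻ x, S ^ (1 / 2 : ℝ) * (∑' i, a i x ^ 2) ^ (1 / 2 : ℝ) ∂μ := by
          refine lintegral_mono fun x => ?_
          refine (ENNReal.inner_le_Lp_mul_Lq s b (fun i => a i x)
            (p := 2) (q := 2) (by rw [Real.holderConjugate_iff]; norm_num)).trans ?_
          simp only [ENNReal.rpow_ofNat]
          gcongr
          exact ENNReal.sum_le_tsum s
      _ = S ^ (1 / 2 : ℝ) * T := lintegral_const_mul' _ _ hSr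
  by_cases hS0 : S = 0
  · rw [hS0]; exact zero_le
  have hSr0 : S ^ (1 / 2 : ℝ) ≠ 0 := by
    simp [ENNReal.rpow_eq_zero_iff, hS0, hSt]
  have hST : S ^ (1 / 2 : ℝ) ≤ T := by
    -- Cancel the factor `S ^ (1 / 2)`, which is neither `0` nor `∞`.
    refine (ENNReal.mul_le_mul_iff_right hSr0 hSr).mp ?_
    rw [← hsq]
    exact hle
  rw [hsq, sq]
  exact mul_le_mul' hST hST

/-- The balls of radius `1 / 2` around the members of an orthonormal family are disjoint. -/
lemma countable_of_hilbertBasis {J Y : Type*} [NormedAddCommGroup Y] [InnerProductSpace ℝ Y]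
    [TopologicalSpace.SeparableSpace Y] (b : HilbertBasis J ℝ Y) : Countable J := by
  have hdist : ∀ i j, i ≠ j → 1 ≤ dist (b i) (b j) := by
    intro i j hij
    have h := norm_sub_sq_real (b i) (b j)
    rw [b.orthonormal.1 i, b.orthonormal.1 j, b.orthonormal.2 hij] at h
    rw [dist_eq_norm]
    nlinarith [norm_nonneg (b i - b j)]
  refine Pairwise.countable_of_isOpen_disjoint (s := fun i => Metric.ball (b i) (1 / 2))
    (fun i j hij => ?_) (fun i => Metric.isOpen_ball) fun i => ⟨b i, by simp⟩
  exact Metric.ball_disjoint_ball (by linarith [hdist i j hij])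

lemma enorm_sq_eq_tsum_inner {J Y : Type*} [NormedAddCommGroup Y] [InnerProductSpace ℝ Y]
    (b : HilbertBasis J ℝ Y) (y : Y) : ‖y‖ₑ ^ 2 = ∑' j, ‖inner ℝ (b j) y‖ₑ ^ 2 := by
  have h := b.hasSum_inner_mul_inner y y
  have h2 : HasSum (fun j => ‖inner ℝ (b j) y‖ ^ 2) (‖y‖ ^ 2) := by
    rw [real_inner_self_eq_norm_sq] at h
    refine h.congr_fun ?_
    intro j
    rw [real_inner_comm, Real.norm_eq_abs, sq_abs, sq]
  rw [← ofReal_norm, ← ENNReal.ofReal_pow (norm_nonneg _), ← h2.tsum_eq,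
    ENNReal.ofReal_tsum_of_nonneg (fun _ => by positivity) h2.summable]
  refine tsum_congr fun j => ?_
  rw [ENNReal.ofReal_pow (norm_nonneg _), ofReal_norm]

section

variable {ι H Y : Type*} [NormedAddCommGroup H] [InnerProductSpace ℝ H]
  [NormedAddCommGroup Y] [InnerProductSpace ℝ Y] {e : HilbertBasis ι ℝ H}

/-- Every square summable family in `Y` is the family of columns of a Hilbert–Schmidt operator, the
pointwise limit of finite rank operators. -/
lemma exists_hilbertSchmidt_of_summable [CompleteSpace H] [CompleteSpace Y] [Countable ι]
    (g : ι → Y) (hg : Summable fun k => ‖g k‖ ^ 2) :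
    ∃ G : HilbertSchmidt e Y, ∀ k, G.1 (e k) = g k := by
  classical
  have hs : ∀ h : H, Summable fun k => inner ℝ (e k) h • g k := by
    intro h
    have h1 : Summable fun k => inner ℝ (e k) h ^ 2 := by
      refine (e.summable_inner_mul_inner h h).congr fun k => ?_
      rw [real_inner_comm, sq]
    refine Summable.of_norm_bounded (h1.add hg) fun k => ?_
    rw [norm_smul, Real.norm_eq_abs, ← sq_abs (inner ℝ (e k) h)]
    nlinarith [sq_nonneg (|inner ℝ (e k) h| - ‖g k‖), sq_nonneg (|inner ℝ (e k) h| + ‖g k‖),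
      mul_nonneg (abs_nonneg (inner ℝ (e k) h)) (norm_nonneg (g k))]
  have ht : Tendsto (fun (s : Finset ι) (h : H) =>
      (∑ k ∈ s, (innerSL ℝ (e k)).smulRight (g k) : H →L[ℝ] Y) h) atTop
      (𝓝 fun h => ∑' k, inner ℝ (e k) h • g k) := by
    rw [tendsto_pi_nhds]
    intro h
    refine (hs h).hasSum.congr fun s => ?_
    simp
  have hcol : ∀ k, continuousLinearMapOfTendsto _ ht (e k) = g k := by
    intro k
    change ∑' j, inner ℝ (e j) (e k) • g j = g k
    rw [tsum_eq_single k]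
    · rw [real_inner_self_eq_norm_sq, e.orthonormal.1 k]
      simp
    · intro j hj
      rw [e.orthonormal.2 hj, zero_smul]
  refine ⟨⟨continuousLinearMapOfTendsto _ ht, ?_⟩, hcol⟩
  change Summable fun k => ‖continuousLinearMapOfTendsto _ ht (e k)‖ ^ 2
  simpa only [hcol] using hg

/-- The Hilbert–Schmidt norm through the matrix entries with respect to an orthonormal basis of `Y`. -/
lemma hsNorm_rpow {J : Type*} (b : HilbertBasis J ℝ Y) (G : HilbertSchmidt e Y) (q : ℝ) :
    hsNorm G ^ q = (∑' i : ι × J, ‖inner ℝ (b i.2) (G.1 (e i.1))‖ₑ ^ 2) ^ (q / 2) := by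
  rw [ENNReal.tsum_prod (f := fun k j => ‖inner ℝ (b j) (G.1 (e k))‖ₑ ^ 2)]
  simp only [← enorm_sq_eq_tsum_inner b]
  rw [hsNorm, ← ENNReal.rpow_mul]
  congr 1
  ring

lemma LNorm_eq {J : Type*} (b : HilbertBasis J ℝ Y) (q : ℝ)
    (f : UnitAddTorus (Fin d) → HilbertSchmidt e Y) :
    LNorm q f = (∫⁻ x, (∑' i : ι × J, ‖inner ℝ (b i.2) ((f x).1 (e i.1))‖ₑ ^ 2) ^ (q / 2)
      ∂torusMeasure d) ^ (1 / q) := by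
  rw [LNorm]
  simp only [hsNorm_rpow b]

lemma aemeasurable_hsNorm [Countable ι] {f : UnitAddTorus (Fin d) → HilbertSchmidt e Y}
    (hf : ∀ k, AEStronglyMeasurable (fun x => (f x).1 (e k)) (torusMeasure d)) :
    AEMeasurable (fun x => hsNorm (f x)) (torusMeasure d) :=
  (AEMeasurable.tsum fun k => (hf k).enorm.pow_const 2).pow_const _

/-- For `f ∈ 𝕃^q` an operator with the prescribed columns exists at every point `x`, so the fallback
value `0` in the definition of `hsPartialSum` does not occur. The columns are square summable by
Minkowski's inequality, as `D_n` is bounded and `𝕃^q ⊆ 𝕃^1`. -/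
lemma hsPartialSum_apply [CompleteSpace H] [CompleteSpace Y] [Countable ι] {q : ℝ} (hq : 1 < q)
    {f : UnitAddTorus (Fin d) → HilbertSchmidt e Y} (hf : MemL q f) (n : Fin d → ℕ)
    (x : UnitAddTorus (Fin d)) (k : ι) :
    (hsPartialSum n f x).1 (e k) = partialSum n (fun y => (f y).1 (e k)) x := by
  have hint : ∀ k, Integrable (fun y => (f y).1 (e k)) (torusMeasure d) := fun k =>
    (hf.1 k).integrable (by simpa using hq.le)
  obtain ⟨M, hM⟩ := exists_enorm_partialSum_le (Y := Y) n
  have hmeas := aemeasurable_hsNorm fun k => (hint k).aestronglyMeasurable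
  have hL1 : ∫⁻ y, hsNorm (f y) ∂torusMeasure d ≠ ∞ := by
    refine ne_top_of_le_ne_top hf.2.ne ?_
    have h := ENNReal.lintegral_mul_le_Lp_mul_Lq (torusMeasure d)
      (Real.HolderConjugate.conjExponent hq) hmeas (aemeasurable_const (b := (1 : ℝ≥0∞)))
    simpa [LNorm] using h
  have hsum : ∑' k, ‖partialSum n (fun y => (f y).1 (e k)) x‖ₑ ^ 2 ≠ ∞ := by
    have h1 : ∑' k, ‖partialSum n (fun y => (f y).1 (e k)) x‖ₑ ^ 2 ≤
        (M : ℝ≥0∞) ^ 2 * ∑' k, (∫⁻ y, ‖(f y).1 (e k)‖ₑ ∂torusMeasure d) ^ 2 := by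
      rw [← ENNReal.tsum_mul_left]
      refine ENNReal.tsum_le_tsum fun k => ?_
      rw [← mul_pow]
      gcongr
      exact hM _ x
    refine ne_top_of_le_ne_top ?_ (h1.trans (mul_le_mul_right (tsum_sq_lintegral_le _
      (fun k => (hint k).aestronglyMeasurable.enorm) fun k => (hint k).2.ne) _))
    exact ENNReal.mul_ne_top (ENNReal.pow_ne_top ENNReal.coe_ne_top) (ENNReal.pow_ne_top hL1)
  have hsummable : Summable fun k => ‖partialSum n (fun y => (f y).1 (e k)) x‖ ^ 2 := by
    refine (ENNReal.summable_toReal hsum).congr fun k => ?_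
    rw [ENNReal.toReal_pow, toReal_enorm]
  have hex := exists_hilbertSchmidt_of_summable (e := e) _ hsummable
  rw [hsPartialSum, dif_pos hex]
  exact hex.choose_spec k

end

end RectSum

end

theorem lemma2p2 (d : ℕ) (hd : 1 ≤ d) (q : ℝ) (hq : 1 < q) :
    ∃ C : ℝ≥0,
      ∀ (H : Type*) [NormedAddCommGroup H] [InnerProductSpace ℝ H] [CompleteSpace H]
        [TopologicalSpace.SeparableSpace H]
        (ι : Type*) [Countable ι] (e : HilbertBasis ι ℝ H)
        (Y : Type*) [NormedAddCommGroup Y] [InnerProductSpace ℝ Y] [CompleteSpace Y]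
        [TopologicalSpace.SeparableSpace Y]
        (f : UnitAddTorus (Fin d) → RectSum.HilbertSchmidt e Y), RectSum.MemL q f →
        (∀ n : Fin d → ℕ,
          (∀ x k, (RectSum.hsPartialSum n f x).1 (e k) =
            RectSum.partialSum n (fun y => (f y).1 (e k)) x) ∧
          RectSum.MemL q (RectSum.hsPartialSum n f) ∧
          RectSum.LNorm q (RectSum.hsPartialSum n f) ≤ C * RectSum.LNorm q f) ∧
        (RectSum.ZeroMean f →
          Tendsto (fun n : Fin d → ℕ => RectSum.LNorm q (RectSum.hsPartialSum n f - f))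
            (comap RectSum.minIndex atTop) (𝓝 0)) := by
  obtain ⟨K, hK⟩ := RectSum.exists_eLpNorm_fourierSum_le d hq
  have hq0 : 0 < q := by linarith
  refine ⟨K, fun H _ _ _ _ ι _ e Y _ _ _ _ f hf => ?_⟩
  obtain ⟨J, b, -⟩ := exists_hilbertBasis ℝ Y
  have hJ : Countable J := RectSum.countable_of_hilbertBasis b
  have hint : ∀ k, Integrable (fun y => (f y).1 (e k)) (RectSum.torusMeasure d) := fun k =>
    (hf.1 k).integrable (by simpa using hq.le)
  set φ : ι × J → UnitAddTorus (Fin d) → ℝ := fun i x => inner ℝ (b i.2) ((f x).1 (e i.1)) with hφ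
  have hφm : ∀ i, MemLp (φ i) (ENNReal.ofReal q) (RectSum.torusMeasure d) := fun i =>
    (hf.1 i.1).const_inner (b i.2)
  have hcol : ∀ n x k, (RectSum.hsPartialSum n f x).1 (e k) =
      RectSum.partialSum n (fun y => (f y).1 (e k)) x :=
    fun n x k => RectSum.hsPartialSum_apply hq hf n x k
  have hcoord : ∀ n x (i : ι × J), inner ℝ (b i.2) ((RectSum.hsPartialSum n f x).1 (e i.1)) =
      RectSum.partialSum n (φ i) x := by
    intro n x i
    rw [hcol]
    exact RectSum.clm_apply_partialSum n (hint i.1) (innerSL ℝ (b i.2)) x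
  have hbound : ∀ n, RectSum.LNorm q (RectSum.hsPartialSum n f) ≤ K * RectSum.LNorm q f := by
    intro n
    rw [RectSum.LNorm_eq b, RectSum.LNorm_eq b]
    simp only [hcoord]
    refine (ENNReal.rpow_le_rpow (RectSum.lintegral_tsum_sq_partialSum_le hq hK φ hφm n)
      (by positivity)).trans (le_of_eq ?_)
    rw [ENNReal.mul_rpow_of_nonneg _ _ (by positivity), ← ENNReal.rpow_mul,
      mul_one_div_cancel hq0.ne', ENNReal.rpow_one]
  refine ⟨fun n => ⟨hcol n, ⟨fun k => ?_, ?_⟩, hbound n⟩, fun _ => ?_⟩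
  · simp only [hcol]
    exact RectSum.memLp_of_continuous (RectSum.continuous_partialSum n (hint k)) _
  · exact (hbound n).trans_lt (ENNReal.mul_lt_top ENNReal.coe_lt_top hf.2)
  · have hfin : ∫⁻ x, (∑' i, ‖φ i x‖ₑ ^ 2) ^ (q / 2) ∂(RectSum.torusMeasure d) ≠ ∞ := by
      have h := hf.2.ne
      rw [RectSum.LNorm_eq b] at h
      intro htop
      refine h ?_
      rw [← ENNReal.top_rpow_of_pos (y := 1 / q) (by positivity), ← htop]
    have ht := (RectSum.tendsto_lintegral_tsum_sq_partialSum_sub hd hq φ hφm hfin).ennrpow_const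
      (1 / q)
    rw [ENNReal.zero_rpow_of_pos (by positivity)] at ht
    refine ht.congr fun n => ?_
    rw [RectSum.LNorm_eq b]
    congr 1
    refine lintegral_congr fun x => ?_
    congr 1
    refine tsum_congr fun i => ?_
    rw [← hcoord, hφ]
    simp [inner_sub_right]
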